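/- \textbf{Theorem 4.4.} Let $Q=Q_1Q_2Q_3Q_4$ be a (nondegenerate) convex quadrilateral in the plane, with vertices named anticlockwise so that the diagonal $Q_1Q_3$ is not longer than the diagonal $Q_2Q_4$. Every $x\in Q$ has a unique representation $x=\sum_{i=1}^4\alpha_iQ_i$ with $\alpha_i\ge 0$, $\sum_i\alpha_i=1$ and $\alpha_2=0$ or $\alpha_4=0$; for a quadrilateral $R=R_1R_2R_3R_4$ put $P_R(x)=\sum_i\alpha_iR_i$. For an integer $m\ge 4$ let $A$ be the set of all $k=(k_1,k_2,k_3,k_4)$ of non-negative integers with $k_1+k_2+k_3+k_4=m-1$ and $k_2=0$ or $k_4=0$. For $k\in A$ let $S_m(k)=R_1R_2R_3R_4$, where $$R_1=\tfrac1m\Big(Q_1+\sum_i k_iQ_i\Big),\qquad R_3=\tfrac1m\Big(Q_3+\sum_i k_iQ_i\Big),$$ $R_2=\frac1m\big(Q_2+\sum_i k_iQ_i\big)$ if $k_4=0$ and $R_2=\frac1m\big(Q_1+Q_3-Q_4+\sum_i k_iQ_i\big)$ if $k_4\ne0$, and $R_4=\frac1m\big(Q_4+\sum_i k_iQ_i\big)$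 if $k_2=0$ and $R_4=\frac1m\big(Q_1-Q_2+Q_3+\sum_i k_iQ_i\big)$ if $k_2\neq 0$. These $m^2$ quadrilaterals subdivide $Q$; call $S_m(k)$ a border quadrilateral if it lies along a side of $Q$, i.e. if all nonzero $k_j$ belong to the two endpoints of one side of $Q$. A set $\mathcal W_1\subseteq\{S_m(k):k\in A\}$ is an $m\times m$ quadrilateral labyrinth set if \begin{enumerate} \item the graph with vertex set $\mathcal W_1$, in which two distinct quadrilaterals are adjacent when they have a common side, is a tree; \item there is exactly one $(k_1,k_2,0,0)\in A$ such that $S_m(k_1,k_2,0,0)$ and $S_m(0,0,k_2,k_1)$ are both in $\mathcal W_1$ (the left and the right exit), and exactly one $(k_1,0,0,k_4)\in A$ such that $S_m(k_1,0,0,k_4)$ and $S_m(0,k_1,k_4,0)$ are both in $\mathcal W_1$ (the top and the bottom exit); \item $\mathcal W_1$ contains at most one of $S_m(m-1,0,0,0)$, $S_m(0,0,m-1,0)$ and at most one of $S_m(0,m-1,0,0)$, $S_m(0,0,0,m-1)$. \end{enumerate} For $n\ge2$ let $\mathcal W_n=\{P_V(U):V\in\mathcal W_{n-1},\,U\in\mathcal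 W_1\}$, where $P_V(U)$ is the quadrilateral whose vertices are the images under $P_V$ of the vertices of $U$, in order, and let $L_\infty=\bigcap_{n\ge1}\bigcup_{W\in\mathcal W_n}W$. Suppose that $m\ge4$ and that $\mathcal W_1$ is an $m\times m$ quadrilateral labyrinth set in $Q$ that contains no border quadrilateral except the exits. Then $Q\setminus L_\infty$ has exactly $4$ connected components; moreover, all four vertices of $Q$ lie in $Q\setminus L_\infty$, and each component contains exactly one of them. -/

import Mathlib

namespace QuadLabyrinth

/-- The Euclidean plane. -/
abbrev Plane : Type := EuclideanSpace ℝ (Fin 2)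

/-- A quadrilateral `R₁R₂R₃R₄`, given by its vertices in cyclic order.
The indices `0, 1, 2, 3` stand for `1, 2, 3, 4`. -/
abbrev Quad : Type := Fin 4 → Plane

/-- The planar cross product. -/
def cross (u v : Plane) : ℝ := u 0 * v 1 - u 1 * v 0

/-- `Q₁Q₂Q₃Q₄` is a (nondegenerate) convex quadrilateral listed anticlockwise:
at each of the four vertices the boundary makes a strict left turn. -/
def IsConvexQuad (Q : Quad) : Prop :=
  ∀ i : Fin 4, 0 < cross (Q (i + 1) - Q i) (Q (i + 2) - Q (i + 1))

/-- The points of a convex quadrilateral. -/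
def carrier (R : Quad) : Set Plane := convexHull ℝ (Set.range R)

/-- `α` is a representation of `x` in `Q`: barycentric coordinates in the triangle `Q₁Q₂Q₃`
(then `α₄ = 0`) or in the triangle `Q₃Q₄Q₁` (then `α₂ = 0`). -/
def IsRep (Q : Quad) (x : Plane) (α : Fin 4 → ℝ) : Prop :=
  (∀ i, 0 ≤ α i) ∧ ∑ i, α i = 1 ∧ (α 1 = 0 ∨ α 3 = 0) ∧ ∑ i, α i • Q i = x

/-- The representation of a point `x` of `Q`. It exists and is unique if `Q` is convex and
`x` lies in `Q`; for other points the value is irrelevant. -/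
noncomputable def rep (Q : Quad) (x : Plane) : Fin 4 → ℝ := Classical.epsilon (IsRep Q x)

/-- The map `P_R : Q → R`, `∑ αᵢ Qᵢ ↦ ∑ αᵢ Rᵢ`. -/
noncomputable def P (Q R : Quad) (x : Plane) : Plane := ∑ i, rep Q x i • R i

def A₁ (m : ℕ) : Set (Fin 4 → ℕ) := {k | k 0 + k 1 + k 2 + 1 = m ∧ k 3 = 0 ∧ k 1 ≠ 0}

def A₂ (m : ℕ) : Set (Fin 4 → ℕ) := {k | k 0 + k 2 + k 3 + 1 = m ∧ k 1 = 0 ∧ k 3 ≠ 0}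

def A₃ (m : ℕ) : Set (Fin 4 → ℕ) := {k | k 0 + k 2 + 1 = m ∧ k 1 = 0 ∧ k 3 = 0}

/-- The index set of the subdivision of `Q` into `m²` quadrilaterals. -/
def A (m : ℕ) : Set (Fin 4 → ℕ) := A₁ m ∪ A₂ m ∪ A₃ m

/-- The point `((k₁+c₁)Q₁ + (k₂+c₂)Q₂ + (k₃+c₃)Q₃ + (k₄+c₄)Q₄) / m`. -/
noncomputable def gridPoint (Q : Quad) (m : ℕ) (k : Fin 4 → ℕ) (c : Fin 4 → ℝ) : Plane :=
  (m : ℝ)⁻¹ • ∑ i, ((k i : ℝ) + c i) • Q i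

/-- The quadrilateral `S_m(k₁,k₂,k₃,k₄)`; for `k ∈ A m` the three cases are
`k ∈ A₁ m`, `k ∈ A₂ m` and `k ∈ A₃ m`. -/
noncomputable def S (Q : Quad) (m : ℕ) (k : Fin 4 → ℕ) : Quad :=
  if k 1 ≠ 0 then
    ![gridPoint Q m k ![1, 0, 0, 0], gridPoint Q m k ![0, 1, 0, 0],
      gridPoint Q m k ![0, 0, 1, 0], gridPoint Q m k ![1, -1, 1, 0]]
  else if k 3 ≠ 0 then
    ![gridPoint Q m k ![1, 0, 0, 0], gridPoint Q m k ![1, 0, 1, -1],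
      gridPoint Q m k ![0, 0, 1, 0], gridPoint Q m k ![0, 0, 0, 1]]
  else
    ![gridPoint Q m k ![1, 0, 0, 0], gridPoint Q m k ![0, 1, 0, 0],
      gridPoint Q m k ![0, 0, 1, 0], gridPoint Q m k ![0, 0, 0, 1]]

/-- The set `𝒮_m` of all quadrilaterals of the subdivision. -/
def grid (Q : Quad) (m : ℕ) : Set Quad := S Q m '' A m

/-- The quadrilaterals `R` and `T` have a common side. -/
def HaveCommonSide (R T : Quad) : Prop :=
  ∃ i j : Fin 4, segment ℝ (R i) (R (i + 1)) = segment ℝ (T j) (T (j + 1))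

/-- The graph of a set of white quadrilaterals: two distinct ones are adjacent if they have a
common side. -/
def whiteGraph (W : Set Quad) : SimpleGraph W where
  Adj R T := R ≠ T ∧ HaveCommonSide R.1 T.1
  symm := ⟨fun _ _ h => ⟨h.1.symm, let ⟨i, j, e⟩ := h.2; ⟨j, i, e.symm⟩⟩⟩
  loopless := ⟨fun _ h => h.1 rfl⟩

/-- `k = (k₁,k₂,0,0) ∈ A` with `S_m(k₁,k₂,0,0)` and `S_m(0,0,k₂,k₁)` both white. -/
def IsLeftRightPair (Q : Quad) (m : ℕ) (W : Set Quad) (k : Fin 4 → ℕ) : Prop :=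
  k ∈ A m ∧ k 2 = 0 ∧ k 3 = 0 ∧ S Q m k ∈ W ∧ S Q m ![0, 0, k 1, k 0] ∈ W

/-- `k = (k₁,0,0,k₄) ∈ A` with `S_m(k₁,0,0,k₄)` and `S_m(0,k₁,k₄,0)` both white. -/
def IsTopBottomPair (Q : Quad) (m : ℕ) (W : Set Quad) (k : Fin 4 → ℕ) : Prop :=
  k ∈ A m ∧ k 1 = 0 ∧ k 2 = 0 ∧ S Q m k ∈ W ∧ S Q m ![0, k 0, k 3, 0] ∈ W

/-- `W` is an `m × m` quadrilateral labyrinth set in `Q` (where `m ≥ 4`). -/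
structure IsLabyrinthSet (Q : Quad) (m : ℕ) (W : Set Quad) : Prop where
  subset_grid : W ⊆ grid Q m
  tree : (whiteGraph W).IsTree
  exit_left_right : ∃! k : Fin 4 → ℕ, IsLeftRightPair Q m W k
  exit_top_bottom : ∃! k : Fin 4 → ℕ, IsTopBottomPair Q m W k
  corner₁₃ : ¬ (S Q m ![m - 1, 0, 0, 0] ∈ W ∧ S Q m ![0, 0, m - 1, 0] ∈ W)
  corner₂₄ : ¬ (S Q m ![0, m - 1, 0, 0] ∈ W ∧ S Q m ![0, 0, 0, m - 1] ∈ W)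

/-- `R` is the left, right, top or bottom exit of `W`. -/
def IsExit (Q : Quad) (m : ℕ) (W : Set Quad) (R : Quad) : Prop :=
  (∃ k, IsLeftRightPair Q m W k ∧ (R = S Q m k ∨ R = S Q m ![0, 0, k 1, k 0])) ∨
  (∃ k, IsTopBottomPair Q m W k ∧ (R = S Q m k ∨ R = S Q m ![0, k 0, k 3, 0]))

/-- `S_m(k)` is a border quadrilateral, i.e. it lies along some side `QᵢQᵢ₊₁` of `Q`: at most two
of the `kⱼ` are nonzero, and these belong to the endpoints of a side of `Q`. -/
def IsBorderIndex (k : Fin 4 → ℕ) : Prop :=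
  ∃ i : Fin 4, ∀ j : Fin 4, k j ≠ 0 → j = i ∨ j = i + 1

/-- The set `𝒲_{n+1}` of white quadrilaterals of order `n + 1` generated by `W = 𝒲₁`. The
quadrilateral `P_V(U)` is given by its vertices `P_V(U₁), …, P_V(U₄)`. -/
def white (Q : Quad) (W : Set Quad) : ℕ → Set Quad
  | 0 => W
  | n + 1 => {R | ∃ V ∈ white Q W n, ∃ U ∈ W, R = fun i => P Q V (U i)}

/-- The labyrinth fractal `L_∞`, the intersection over all orders of the unions of the white
quadrilaterals of that order. -/
def fractal (Q : Quad) (W : Set Quad) : Set Plane :=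
  ⋂ n : ℕ, ⋃ R ∈ white Q W n, carrier R

end QuadLabyrinth

open QuadLabyrinth

/-!
A quadrilateral is an affine image of the unit square on each side of a diagonal, so one may work in
the square, with a pattern of white cells in the `m × m` grid whose adjacency graph is a tree.

Say that two vertices of a black cell are equivalent. The classes of the lattice points are exactly
the classes of the four corners. Every class contains a corner: otherwise the sides of white cells
that separate the class from its complement would give a nonempty forest without leaves among the
white cells. Distinct corners are inequivalent: a path of white cells between opposite exits
separates them. Both facts pass from one order to the next by self-similarity, which yields
connections to the corners on the one hand and a locally constant function on the other.
-/

namespace QuadLabyrinth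

/-! ### Square labyrinth patterns -/

section

theorem eq_bot_of_isAcyclic {V : Type*} [Finite V] {G : SimpleGraph V} (hG : G.IsAcyclic)
    (h : ∀ u v, G.Adj u v → ∃ x ≠ u, G.Adj v x) : G = ⊥ := by
  by_contra hne
  obtain ⟨u, v, huv⟩ := SimpleGraph.ne_bot_iff_exists_adj.1 hne
  have : Nonempty V := ⟨u⟩
  obtain ⟨a, b, p, hp, hmax⟩ := SimpleGraph.Walk.exists_isPath_forall_isPath_length_le_length G
  have hlen : 0 < p.length := hmax _ _ (.cons huv .nil) (by simp [huv.ne])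
  have hnil : ¬ p.Nil := fun hn => by simp [SimpleGraph.Walk.length_eq_zero_iff.2 hn] at hlen
  obtain ⟨x, hx, hbx⟩ := h _ _ (p.adj_penultimate hnil)
  have hsupp : x ∉ p.support := fun hs => hx (hG.eq_penultimate_of_adj_end hp hbx hs)
  simpa using hmax _ _ _ (hp.concat hsupp hbx)

/-- The vertices of the cell `[a.1, a.1 + 1] × [a.2, a.2 + 1]`, anticlockwise from the bottom left
one. Side `i` of a cell joins the vertices `i` and `i + 1`. -/
def vertex (a : ℕ × ℕ) : Fin 4 → ℕ × ℕ :=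
  ![(a.1, a.2), (a.1 + 1, a.2), (a.1 + 1, a.2 + 1), (a.1, a.2 + 1)]

/-- Side `i` of the cell `a` is the opposite side of the cell `b`. -/
def SharesSide (i : Fin 4) (a b : ℕ × ℕ) : Prop :=
  vertex a i = vertex b (i + 3) ∧ vertex a (i + 1) = vertex b (i + 2)

/-- The two cells have a common side. -/
def Neighbor (a b : ℕ × ℕ) : Prop := ∃ i, SharesSide i a b

variable {m c r : ℕ} {a b : ℕ × ℕ} {w C : Set (ℕ × ℕ)}

theorem SharesSide.symm {i : Fin 4} (h : SharesSide i a b) : SharesSide (i + 2) b a := by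
  refine ⟨?_, ?_⟩
  · rw [add_assoc]; exact h.2.symm
  · rw [add_assoc, add_assoc, show (2 + 1 : Fin 4) = 3 from rfl, show (2 + 2 : Fin 4) = 0 from rfl,
      add_zero]
    exact h.1.symm

theorem neighbor_iff : Neighbor a b ↔
    (a.1 = b.1 ∧ (a.2 = b.2 + 1 ∨ b.2 = a.2 + 1)) ∨
      (a.2 = b.2 ∧ (a.1 = b.1 + 1 ∨ b.1 = a.1 + 1)) := by
  simp only [Neighbor, SharesSide, vertex, Fin.exists_fin_succ, Prod.ext_iff]
  simp
  omega

theorem Neighbor.symm (h : Neighbor a b) : Neighbor b a :=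
  let ⟨_, hi⟩ := h; ⟨_, hi.symm⟩

/-- The adjacency graph of a set of cells. -/
def cellGraph (w : Set (ℕ × ℕ)) : SimpleGraph w where
  Adj a b := Neighbor a b
  symm := ⟨fun _ _ h => h.symm⟩
  loopless := ⟨fun _ h => by have := neighbor_iff.1 h; omega⟩

/-- `w` is the set of white cells of a square labyrinth pattern of width `m` whose only white
border cells are the two exits in column `c` and the two exits in row `r`. -/
structure IsPattern (m : ℕ) (w : Set (ℕ × ℕ)) (c r : ℕ) : Prop where
  lt : ∀ a ∈ w, a.1 < m ∧ a.2 < m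
  left : ∀ y, (0, y) ∈ w ↔ y = r
  right : ∀ y, (m - 1, y) ∈ w ↔ y = r
  bottom : ∀ x, (x, 0) ∈ w ↔ x = c
  top : ∀ x, (x, m - 1) ∈ w ↔ x = c
  c_pos : 0 < c
  c_lt : c + 1 < m
  r_pos : 0 < r
  r_lt : r + 1 < m
  tree : (cellGraph w).IsTree

/-- Reflection in the diagonal, as an isomorphism of adjacency graphs. -/
def cellGraphSwap (w : Set (ℕ × ℕ)) : cellGraph w ≃g cellGraph (Prod.swap ⁻¹' w) where
  toFun a := ⟨a.1.swap, by simp⟩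
  invFun a := ⟨a.1.swap, a.2⟩
  left_inv _ := by simp
  right_inv _ := by simp
  map_rel_iff' {a b} := by
    simp only [cellGraph, Equiv.coe_fn_mk, neighbor_iff, Prod.fst_swap, Prod.snd_swap]
    omega

theorem IsPattern.swap (h : IsPattern m w c r) : IsPattern m (Prod.swap ⁻¹' w) r c where
  lt _ ha := (h.lt _ ha).symm
  left := h.bottom
  right := h.top
  bottom := h.left
  top := h.right
  c_pos := h.r_pos
  c_lt := h.r_lt
  r_pos := h.c_pos
  r_lt := h.c_lt
  tree := (cellGraphSwap w).isTree_iff.1 h.tree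

theorem IsPattern.finite (h : IsPattern m w c r) : Finite w :=
  ((Set.finite_Iio m).prod (Set.finite_Iio m)).subset h.lt

theorem forall_le_of_step {D : ℕ → Prop} {e : ℕ} (he : e < m) (h0 : D 0) (hm : D m)
    (hD : ∀ j < m, j ≠ e → (D j ↔ D (j + 1))) : ∀ j ≤ m, D j := by
  have up (j : ℕ) (hj : j ≤ e) : D j :=
    Nat.rec (fun _ => h0) (fun j ih hj => (hD j (by omega) (by omega)).1 (ih (by omega))) j hj
  have down (j : ℕ) (hj : j ≤ m) : e < j → D j :=
    Nat.decreasingInduction (motive := fun j _ => e < j → D j)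
      (fun j hj ih he => (hD j hj he.ne').2 (ih (by omega))) (fun _ => hm) hj
  intro j hj
  exact (le_or_gt j e).elim (up j) (down j hj)

/-- The corners of the `m × m` grid, in the order of the vertices of a cell. -/
def gridCorner (m : ℕ) : Fin 4 → ℕ × ℕ := ![(0, 0), (m, 0), (m, m), (0, m)]

/-- `C` contains with one vertex of a black cell all of them. -/
def ConstantOnBlack (m : ℕ) (w C : Set (ℕ × ℕ)) : Prop :=
  ∀ a : ℕ × ℕ, a.1 < m → a.2 < m → a ∉ w → ∀ i j, vertex a i ∈ C ↔ vertex a j ∈ C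

theorem IsPattern.mem_of_mem_border (h : IsPattern m w c r) (hC : ConstantOnBlack m w C)
    (hcorner : ∀ i, gridCorner m i ∈ C) {v : ℕ × ℕ} (hv₁ : v.1 ≤ m) (hv₂ : v.2 ≤ m)
    (hv : v.1 = 0 ∨ v.1 = m ∨ v.2 = 0 ∨ v.2 = m) : v ∈ C := by
  obtain ⟨n, rfl⟩ : ∃ n, m = n + 1 := ⟨m - 1, by have := h.c_lt; omega⟩
  have hc := h.c_lt
  have hr := h.r_lt
  obtain ⟨x, y⟩ := v
  obtain rfl | rfl | rfl | rfl := hv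
  · exact forall_le_of_step (D := fun j => (0, j) ∈ C) (e := r) (by omega) (hcorner 0) (hcorner 3)
      (fun j hj hne => hC (0, j) (by simp) hj (by rwa [h.left]) 0 3) y hv₂
  · exact forall_le_of_step (D := fun j => (n + 1, j) ∈ C) (e := r) (by omega) (hcorner 1)
      (hcorner 2) (fun j hj hne => hC (n, j) (by simp) hj (mt (h.right j).1 hne) 1 2) y hv₂
  · exact forall_le_of_step (D := fun j => (j, 0) ∈ C) (e := c) (by omega) (hcorner 0) (hcorner 1)
      (fun j hj hne => hC (j, 0) hj (by simp) (by rwa [h.bottom]) 0 1) x hv₁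
  · exact forall_le_of_step (D := fun j => (j, n + 1) ∈ C) (e := c) (by omega) (hcorner 3)
      (hcorner 2) (fun j hj hne => hC (j, n) hj (by simp) (mt (h.top j).1 hne) 3 2) x hv₁

/-- Exactly one end of side `i` of the cell `a` lies in `C`. -/
def Splits (C : Set (ℕ × ℕ)) (i : Fin 4) (a : ℕ × ℕ) : Prop :=
  ¬(vertex a i ∈ C ↔ vertex a (i + 1) ∈ C)

theorem SharesSide.splits_iff {i : Fin 4} (h : SharesSide i a b) (C : Set (ℕ × ℕ)) :
    Splits C i a ↔ Splits C (i + 2) b := by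
  rw [Splits, Splits, h.1, h.2, add_assoc, iff_comm (a := _ ∈ C)]
  rfl

theorem Splits.exists_ne {i : Fin 4} (h : Splits C i a) :
    ∃ j ≠ i, Splits C j a := by
  by_contra! hall
  have hstep (j : Fin 4) (hj : j ≠ i) : vertex a j ∈ C ↔ vertex a (j + 1) ∈ C :=
    not_not.1 (hall j hj)
  have h₁ := hstep (i + 1) (by simp)
  have h₂ := hstep (i + 2) (by simp)
  have h₃ := hstep (i + 3) (by simp)
  simp only [add_assoc] at h₁ h₂ h₃
  exact h ((h₁.trans (h₂.trans (h₃.trans (by simp)))).symm)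

theorem SharesSide.eq {i j : Fin 4} (hi : SharesSide i a b) (hj : SharesSide j a b) : i = j := by
  fin_cases i <;> fin_cases j <;> simp [SharesSide, vertex, Prod.ext_iff] at hi hj ⊢ <;> omega

theorem exists_sharesSide_or_border (ha₁ : a.1 < m) (ha₂ : a.2 < m) (i : Fin 4) :
    (∃ b : ℕ × ℕ, b.1 < m ∧ b.2 < m ∧ SharesSide i a b) ∨
      (vertex a i).1 = 0 ∧ (vertex a (i + 1)).1 = 0 ∨
      (vertex a i).1 = m ∧ (vertex a (i + 1)).1 = m ∨
      (vertex a i).2 = 0 ∧ (vertex a (i + 1)).2 = 0 ∨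
      (vertex a i).2 = m ∧ (vertex a (i + 1)).2 = m := by
  obtain ⟨x, y⟩ := a
  simp only at ha₁ ha₂
  fin_cases i
  · rcases y with _ | y
    · simp [vertex]
    · exact .inl ⟨(x, y), ha₁, by omega, rfl, rfl⟩
  · rcases (show x + 1 ≤ m from ha₁).lt_or_eq with hx | hx
    · exact .inl ⟨(x + 1, y), hx, ha₂, rfl, rfl⟩
    · simp [vertex, hx]
  · rcases (show y + 1 ≤ m from ha₂).lt_or_eq with hy | hy
    · exact .inl ⟨(x, y + 1), ha₁, hy, rfl, rfl⟩
    · simp [vertex, hy]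
  · rcases x with _ | x
    · simp [vertex]
    · exact .inl ⟨(x, y), by omega, ha₂, rfl, rfl⟩

theorem vertex_le (ha₁ : a.1 < m) (ha₂ : a.2 < m) (i : Fin 4) :
    (vertex a i).1 ≤ m ∧ (vertex a i).2 ≤ m := by
  fin_cases i <;> simp [vertex] <;> omega

theorem Splits.exists_sharesSide (h : IsPattern m w c r) (hC : ConstantOnBlack m w C)
    (hcorner : ∀ i, gridCorner m i ∈ C) (ha : a ∈ w) {i : Fin 4} (hi : Splits C i a) :
    ∃ b ∈ w, SharesSide i a b := by
  have hlt := h.lt a ha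
  rcases exists_sharesSide_or_border hlt.1 hlt.2 i with ⟨b, hb₁, hb₂, hab⟩ | hborder
  · refine ⟨b, by_contra fun hb => ?_, hab⟩
    exact (hab.splits_iff C).1 hi (hC b hb₁ hb₂ hb _ _)
  · have hv (j : Fin 4) := vertex_le hlt.1 hlt.2 j
    have hmem (j : Fin 4) := h.mem_of_mem_border hC hcorner (hv j).1 (hv j).2
    exact absurd (iff_of_true (hmem i (by tauto)) (hmem (i + 1) (by tauto))) hi

theorem IsPattern.not_splits (h : IsPattern m w c r) (hC : ConstantOnBlack m w C)
    (hcorner : ∀ i, gridCorner m i ∈ C) (ha₁ : a.1 < m) (ha₂ : a.2 < m) (i : Fin 4) :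
    ¬Splits C i a := by
  intro hi
  have ha : a ∈ w := by_contra fun ha => hi (hC a ha₁ ha₂ ha _ _)
  let G : SimpleGraph w :=
    { Adj a b := ∃ i, SharesSide i a b ∧ Splits C i a
      symm := ⟨fun _ _ ⟨i, hab, hi⟩ => ⟨i + 2, hab.symm, (hab.splits_iff C).1 hi⟩⟩
      loopless := ⟨fun a ⟨i, hab, _⟩ => (cellGraph w).loopless.irrefl a ⟨i, hab⟩⟩ }
  have := h.finite
  -- Every cell has an even number of split sides, so the forest `G` has no leaves.
  have hG : G = ⊥ := by
    refine eq_bot_of_isAcyclic (h.tree.isAcyclic.anti ?_) ?_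
    · exact fun _ _ ⟨i, hab, _⟩ => ⟨i, hab⟩
    rintro u v ⟨i, huv, hi⟩
    obtain ⟨j, hji, hj⟩ := ((huv.splits_iff C).1 hi).exists_ne
    obtain ⟨x, hx, hvx⟩ := hj.exists_sharesSide h hC hcorner v.2
    refine ⟨⟨x, hx⟩, ?_, j, hvx, hj⟩
    rintro rfl
    exact hji (hvx.eq huv.symm)
  obtain ⟨b, hb, hab⟩ := hi.exists_sharesSide h hC hcorner ha
  have hadj : G.Adj ⟨a, ha⟩ ⟨b, hb⟩ := ⟨i, hab, hi⟩
  rwa [hG] at hadj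

theorem IsPattern.mem_of_constantOnBlack (h : IsPattern m w c r) (hC : ConstantOnBlack m w C)
    (hcorner : ∀ i, gridCorner m i ∈ C) {v : ℕ × ℕ} (hv₁ : v.1 ≤ m) (hv₂ : v.2 ≤ m) : v ∈ C := by
  rcases hv₁.eq_or_lt with hx | hx
  · exact h.mem_of_mem_border hC hcorner hv₁ hv₂ (.inr (.inl hx))
  have hcol (y : ℕ) (hy : y ≤ m) : (v.1, y) ∈ C := by
    induction y with
    | zero => exact h.mem_of_mem_border hC hcorner hv₁ hy (by simp)
    | succ y ih =>
      exact (not_not.1 (h.not_splits hC hcorner (a := (v.1, y)) hx hy 3)).2 (ih (by omega))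
  exact hcol v.2 hv₂

/-- `C` is the set of lattice points to the right of a curve that enters at the bottom of column
`c`, runs through cells of `w` up to the cell `b` and leaves from there straight up. -/
structure IsRightOfPath (m : ℕ) (w : Set (ℕ × ℕ)) (c : ℕ) (b : ℕ × ℕ) (C : Set (ℕ × ℕ)) :
    Prop where
  left : ∀ y, (0, y) ∉ C
  right : ∀ y, (m, y) ∈ C
  bottom : ∀ x, (x, 0) ∈ C ↔ c < x
  horiz : ∀ x y, ¬((x, y) ∈ w ∧ (x, y + 1) ∈ w) →
    (((x, y + 1) ∈ C ↔ (x + 1, y + 1) ∈ C) ↔ ¬(x = b.1 ∧ b.2 ≤ y))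
  vert : ∀ x y, ¬((x, y) ∈ w ∧ (x + 1, y) ∈ w) → ((x + 1, y) ∈ C ↔ (x + 1, y + 1) ∈ C)

theorem IsRightOfPath.of_column (hc : c < m) : IsRightOfPath m w c (c, 0) {v | c < v.1} where
  left y := by simp
  right _ := hc
  bottom _ := Iff.rfl
  horiz x y _ := by
    simp only [Set.mem_ofPred_eq]
    omega
  vert _ _ _ := Iff.rfl

theorem IsRightOfPath.congr_column (h : IsRightOfPath m w c a C) (ha : a ∈ w)
    (hb : b ∈ w) (h₁ : a.1 = b.1) (h₂ : a.2 = b.2 + 1 ∨ b.2 = a.2 + 1) :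
    IsRightOfPath m w c b C where
  left := h.left
  right := h.right
  bottom := h.bottom
  vert := h.vert
  horiz x y hxy := by
    have := h.horiz x y hxy
    grind

theorem IsRightOfPath.toggle_column {x y : ℕ} (h : IsRightOfPath m w c a C)
    (hx : (x, y) ∈ w) (hx' : (x + 1, y) ∈ w) (hxm : x + 1 < m)
    (hab : (a = (x, y) ∧ b = (x + 1, y)) ∨ (a = (x + 1, y) ∧ b = (x, y))) :
    IsRightOfPath m w c b {v | ¬(v ∈ C ↔ v.1 = x + 1 ∧ y < v.2)} where
  left z := by simp [h.left]
  right z := by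
    have : m ≠ x + 1 := hxm.ne'
    simp [h.right, this]
  bottom z := by simp [h.bottom]
  vert x' y' hxy := by
    have := h.vert x' y' hxy
    simp only [Set.mem_ofPred_eq]
    grind
  horiz x' y' hxy := by
    have := h.horiz x' y' hxy
    simp only [Set.mem_ofPred_eq]
    grind

theorem exists_isRightOfPath (hlt : ∀ a ∈ w, a.1 < m) (hconn : (cellGraph w).Preconnected)
    (hc : (c, 0) ∈ w) (b : w) : ∃ C, IsRightOfPath m w c b C := by
  induction (SimpleGraph.reachable_iff_reflTransGen _ _).1 (hconn ⟨_, hc⟩ b) with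
  | refl => exact ⟨_, .of_column (hlt _ hc)⟩
  | @tail a b _ hab ih =>
    obtain ⟨C, hC⟩ := ih
    obtain ⟨⟨a₁, a₂⟩, ha⟩ := a
    obtain ⟨⟨b₁, b₂⟩, hb⟩ := b
    rcases neighbor_iff.1 hab with ⟨h₁, h₂⟩ | ⟨h₁, h₂ | h₂⟩
    · exact ⟨C, hC.congr_column ha hb h₁ h₂⟩
    · obtain rfl : a₁ = b₁ + 1 := h₂
      obtain rfl : a₂ = b₂ := h₁
      exact ⟨_, hC.toggle_column hb ha (hlt _ ha) (.inr ⟨rfl, rfl⟩)⟩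
    · obtain rfl : b₁ = a₁ + 1 := h₂
      obtain rfl : a₂ = b₂ := h₁
      exact ⟨_, hC.toggle_column ha hb (hlt _ hb) (.inl ⟨rfl, rfl⟩)⟩

theorem IsRightOfPath.constantOnBlack (h : IsRightOfPath m w c (c, m - 1) C)
    (hbot : (c, 0) ∈ w) (htop : (c, m - 1) ∈ w) : ConstantOnBlack m w C := by
  rintro ⟨x, y⟩ - hy ha
  simp only at hy
  have hbottom : (x, y) ∈ C ↔ (x + 1, y) ∈ C := by
    rcases y with _ | y
    · have hxc : x ≠ c := by rintro rfl; exact ha hbot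
      rw [h.bottom, h.bottom]
      omega
    · refine (h.horiz x y fun hw => ha hw.2).2 ?_
      simp only
      omega
  have htop : (x, y + 1) ∈ C ↔ (x + 1, y + 1) ∈ C := by
    refine (h.horiz x y fun hw => ha hw.1).2 fun ⟨hx, hy'⟩ => ha ?_
    rwa [hx, show y = m - 1 by simp only at hy'; omega]
  have hright : (x + 1, y) ∈ C ↔ (x + 1, y + 1) ∈ C := h.vert x y fun hw => ha hw.1
  intro i j
  fin_cases i <;> fin_cases j <;> simp [vertex] <;> tauto

theorem IsPattern.exists_separating (h : IsPattern m w c r) :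
    ∃ C, ConstantOnBlack m w C ∧ (∀ y, (0, y) ∉ C) ∧ (∀ y, (m, y) ∈ C) ∧
      (∀ x, (x, 0) ∈ C ↔ c < x) ∧ ∀ x ≤ m, (x, m) ∈ C ↔ c < x := by
  have hbot : (c, 0) ∈ w := (h.bottom c).2 rfl
  have htop : (c, m - 1) ∈ w := (h.top c).2 rfl
  obtain ⟨C, hC⟩ :=
    exists_isRightOfPath (fun a ha => (h.lt a ha).1) h.tree.connected.preconnected hbot ⟨_, htop⟩
  have hblack := hC.constantOnBlack hbot htop
  have hc := h.c_lt
  refine ⟨C, hblack, hC.left, hC.right, hC.bottom, ?_⟩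
  obtain ⟨n, rfl⟩ : ∃ n, m = n + 1 := ⟨m - 1, by omega⟩
  refine forall_le_of_step (by omega : c < n + 1) (by simp [hC.left]) ?_ fun j hj hne => ?_
  · exact iff_of_true (hC.right _) (by omega)
  · have : (j, n + 1) ∈ C ↔ (j + 1, n + 1) ∈ C :=
      hblack (j, n) hj (by simp) (mt (h.top j).1 hne) 3 2
    rw [this]
    have : c < j ↔ c < j + 1 := by omega
    rw [this]

/-- A numbering of the lattice points by the four corners of the grid which is constant on black
cells and, on opposite sides of the grid, symmetric. -/
structure IsLabelling (m : ℕ) (w : Set (ℕ × ℕ)) (ℓ : ℕ × ℕ → Fin 4) : Prop where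
  black : ∀ a : ℕ × ℕ, a.1 < m → a.2 < m → a ∉ w → ∀ i j, ℓ (vertex a i) = ℓ (vertex a j)
  left_right : ∀ y ≤ m, (ℓ (0, y) = 0 ∨ ℓ (0, y) = 3) ∧ ℓ (m, y) = 1 - ℓ (0, y)
  bottom_top : ∀ x ≤ m, (ℓ (x, 0) = 0 ∨ ℓ (x, 0) = 1) ∧ ℓ (x, m) = 3 - ℓ (x, 0)

/-- The diagonal reflection fixes the corners `0` and `2` and interchanges `1` and `3`. -/
theorem vertex_swap (a : ℕ × ℕ) (i : Fin 4) : vertex a.swap (-i) = (vertex a i).swap := by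
  fin_cases i <;> rfl

theorem IsLabelling.swap {ℓ : ℕ × ℕ → Fin 4} (h : IsLabelling m w ℓ) :
    IsLabelling m (Prod.swap ⁻¹' w) fun v => -ℓ v.swap where
  black a ha₁ ha₂ ha i j := by
    rw [← vertex_swap, ← vertex_swap, h.black a.swap ha₂ ha₁ ha]
  left_right y hy := by
    have := h.bottom_top y hy
    simp only [Prod.swap_prod_mk]
    generalize ℓ (y, 0) = p at *
    generalize ℓ (y, m) = q at *
    revert p q; decide
  bottom_top y hy := by
    have := h.left_right y hy
    simp only [Prod.swap_prod_mk]
    generalize ℓ (0, y) = p at *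
    generalize ℓ (m, y) = q at *
    revert p q; decide

open Classical in
theorem IsPattern.exists_isLabelling (h : IsPattern m w c r) : ∃ ℓ, IsLabelling m w ℓ := by
  obtain ⟨C, hC, hC₀, hCm, hCb, hCt⟩ := h.exists_separating
  obtain ⟨D, hD, hD₀, hDm, hDb, hDt⟩ := h.swap.exists_separating
  let ℓ (v : ℕ × ℕ) : Fin 4 :=
    if v ∈ C then if v.swap ∈ D then 2 else 1 else if v.swap ∈ D then 3 else 0
  have hblack (a : ℕ × ℕ) (ha₁ : a.1 < m) (ha₂ : a.2 < m) (ha : a ∉ w) (i j : Fin 4) :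
      ℓ (vertex a i) = ℓ (vertex a j) := by
    simp only [ℓ, ← vertex_swap, hC a ha₁ ha₂ ha i j, hD a.swap ha₂ ha₁ ha (-i) (-j)]
  refine ⟨ℓ, hblack, fun y hy => ?_, fun x hx => ?_⟩
  · by_cases hy' : r < y <;> simp [ℓ, hC₀, hCm, hDb, hDt y hy, hy']
  · by_cases hx' : c < x <;> simp [ℓ, hD₀, hDm, hCb, hCt x hx, hx']

end

/-! ### The fractal in the unit square -/

section

open Set

variable {m c r : ℕ} {a b : ℕ × ℕ} {w : Set (ℕ × ℕ)} {z z' : ℝ × ℝ}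

/-- The unit square. -/
def unitSq : Set (ℝ × ℝ) := Icc 0 1 ×ˢ Icc 0 1

/-- The corners of the unit square, in the order of the vertices of a cell. -/
def corner : Fin 4 → ℝ × ℝ := ![(0, 0), (1, 0), (1, 1), (0, 1)]

/-- The homothety from the unit square onto the cell `a` of the `m × m` grid on the unit square. -/
noncomputable def cellMap (m : ℕ) (a : ℕ × ℕ) (z : ℝ × ℝ) : ℝ × ℝ :=
  ((a.1 + z.1) / m, (a.2 + z.2) / m)

/-- The position in the unit square of a vertex of the `m × m` grid. -/
noncomputable def latticePoint (m : ℕ) (v : ℕ × ℕ) : ℝ × ℝ := (v.1 / m, v.2 / m)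

/-- The union of the white cells of order `n`. -/
def whiteUnion (m : ℕ) (w : Set (ℕ × ℕ)) : ℕ → Set (ℝ × ℝ)
  | 0 => unitSq
  | n + 1 => ⋃ a ∈ w, cellMap m a '' whiteUnion m w n

/-- The labyrinth fractal in the unit square. -/
def squareFractal (m : ℕ) (w : Set (ℕ × ℕ)) : Set (ℝ × ℝ) := ⋂ n, whiteUnion m w n

/-- The complement of the labyrinth fractal in the unit square. -/
def squareComplement (m : ℕ) (w : Set (ℕ × ℕ)) : Set (ℝ × ℝ) := unitSq \ squareFractal m w

theorem mem_whiteUnion_succ {n : ℕ} :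
    z ∈ whiteUnion m w (n + 1) ↔ ∃ a ∈ w, ∃ z' ∈ whiteUnion m w n, cellMap m a z' = z := by
  simp [whiteUnion]

theorem corner_mem (i : Fin 4) : corner i ∈ unitSq := by
  fin_cases i <;> simp [corner, unitSq]

theorem cellMap_corner (m : ℕ) (a : ℕ × ℕ) (i : Fin 4) :
    cellMap m a (corner i) = latticePoint m (vertex a i) := by
  fin_cases i <;> simp [cellMap, corner, latticePoint, vertex]

theorem latticePoint_gridCorner (hm : 0 < m) (i : Fin 4) :
    latticePoint m (gridCorner m i) = corner i := by
  fin_cases i <;> simp [latticePoint, gridCorner, corner, hm.ne']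

@[fun_prop]
theorem continuous_cellMap (m : ℕ) (a : ℕ × ℕ) : Continuous (cellMap m a) := by
  unfold cellMap; fun_prop

theorem add_eq_add_cases {i j : ℕ} {s t : ℝ} (hs : s ∈ Icc (0 : ℝ) 1) (ht : t ∈ Icc (0 : ℝ) 1)
    (e : (i : ℝ) + s = j + t) :
    (i = j ∧ s = t) ∨ (j = i + 1 ∧ s = 1 ∧ t = 0) ∨ (i = j + 1 ∧ s = 0 ∧ t = 1) := by
  obtain ⟨hs₀, hs₁⟩ := hs
  obtain ⟨ht₀, ht₁⟩ := ht
  rcases lt_trichotomy i j with h | rfl | h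
  · have h' : (i : ℝ) + 1 ≤ j := by exact_mod_cast h
    refine .inr (.inl ⟨?_, by linarith, by linarith⟩)
    have : (j : ℝ) = (i + 1 : ℕ) := by push_cast; linarith
    exact_mod_cast this
  · exact .inl ⟨rfl, by linarith⟩
  · have h' : (j : ℝ) + 1 ≤ i := by exact_mod_cast h
    refine .inr (.inr ⟨?_, by linarith, by linarith⟩)
    have : (i : ℝ) = (j + 1 : ℕ) := by push_cast; linarith
    exact_mod_cast this

theorem cellMap_eq_cellMap_iff (hm : 0 < m) : cellMap m a z = cellMap m b z' ↔
    (a.1 : ℝ) + z.1 = b.1 + z'.1 ∧ (a.2 : ℝ) + z.2 = b.2 + z'.2 := by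
  have hm' : (m : ℝ) ≠ 0 := by positivity
  simp only [cellMap, Prod.mk.injEq, div_left_inj' hm']

theorem add_div_mem_Icc {i : ℕ} (hi : i < m) {s : ℝ} (hs : s ∈ Icc (0 : ℝ) 1) :
    (i + s) / m ∈ Icc (0 : ℝ) 1 := by
  have h : (i : ℝ) + 1 ≤ m := by exact_mod_cast hi
  obtain ⟨hs₀, hs₁⟩ := hs
  exact ⟨by positivity, div_le_one_of_le₀ (by linarith) (by positivity)⟩

theorem cellMap_mem (ha₁ : a.1 < m) (ha₂ : a.2 < m) (hz : z ∈ unitSq) :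
    cellMap m a z ∈ unitSq :=
  ⟨add_div_mem_Icc ha₁ hz.1, add_div_mem_Icc ha₂ hz.2⟩

/-- The index of a part of the subdivision of `[0, 1]` into `m` parts that contains `t`. The last
part is closed, whence the minimum. -/
noncomputable def digit (m : ℕ) (t : ℝ) : ℕ := min ⌊m * t⌋₊ (m - 1)

theorem digit_lt (hm : 0 < m) (t : ℝ) : digit m t < m := by
  unfold digit; omega

theorem sub_digit_mem (hm : 0 < m) {t : ℝ} (ht : t ∈ Icc (0 : ℝ) 1) :
    m * t - digit m t ∈ Icc (0 : ℝ) 1 := by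
  obtain ⟨n, rfl⟩ : ∃ n, m = n + 1 := ⟨m - 1, by omega⟩
  obtain ⟨ht₀, ht₁⟩ := ht
  have hle := Nat.floor_le (a := ((n + 1 : ℕ) : ℝ) * t) (by positivity)
  have hlt := Nat.lt_floor_add_one (((n + 1 : ℕ) : ℝ) * t)
  rw [digit, Nat.add_sub_cancel]
  rcases le_total ⌊((n + 1 : ℕ) : ℝ) * t⌋₊ n with h | h
  · rw [min_eq_left h]
    exact ⟨by linarith, by linarith⟩
  · rw [min_eq_right h]
    have h' : (n : ℝ) ≤ ⌊((n + 1 : ℕ) : ℝ) * t⌋₊ := by exact_mod_cast h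
    push_cast at *
    exact ⟨by linarith, by nlinarith⟩

/-- A cell containing `z`. -/
noncomputable def cellOf (m : ℕ) (z : ℝ × ℝ) : ℕ × ℕ := (digit m z.1, digit m z.2)

/-- The inverse of the homothety `cellMap m a`. -/
noncomputable def cellInv (m : ℕ) (a : ℕ × ℕ) (z : ℝ × ℝ) : ℝ × ℝ :=
  (m * z.1 - a.1, m * z.2 - a.2)

theorem cellMap_cellInv (hm : 0 < m) (a : ℕ × ℕ) (z : ℝ × ℝ) :
    cellMap m a (cellInv m a z) = z := by
  have hm' : (m : ℝ) ≠ 0 := by positivity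
  simp [cellMap, cellInv, hm']

theorem cellInv_cellMap (hm : 0 < m) (a : ℕ × ℕ) (z : ℝ × ℝ) :
    cellInv m a (cellMap m a z) = z := by
  have hm' : (m : ℝ) ≠ 0 := by positivity
  simp [cellMap, cellInv, mul_div_cancel₀ _ hm']

theorem continuous_cellInv (m : ℕ) (a : ℕ × ℕ) : Continuous (cellInv m a) := by
  unfold cellInv; fun_prop

theorem cellInv_cellOf_mem (hm : 0 < m) (hz : z ∈ unitSq) :
    cellInv m (cellOf m z) z ∈ unitSq :=
  ⟨sub_digit_mem hm hz.1, sub_digit_mem hm hz.2⟩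

theorem exists_cellMap_eq (hm : 0 < m) (hz : z ∈ unitSq) :
    ∃ a : ℕ × ℕ, a.1 < m ∧ a.2 < m ∧ ∃ z' ∈ unitSq, cellMap m a z' = z :=
  ⟨cellOf m z, digit_lt hm _, digit_lt hm _, _, cellInv_cellOf_mem hm hz, cellMap_cellInv hm _ _⟩

theorem cellMap_left (m j : ℕ) (s : ℝ) : cellMap m (0, j) (0, s) = (0, (j + s) / m) := by
  simp [cellMap]

theorem cellMap_right (hm : 0 < m) (j : ℕ) (s : ℝ) :
    cellMap m (m - 1, j) (1, s) = (1, (j + s) / m) := by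
  have hm' : (m : ℝ) ≠ 0 := by positivity
  simp [cellMap, Nat.cast_sub (show 1 ≤ m from hm), hm']

theorem eq_zero_of_add_div {i : ℕ} (hm : 0 < m) {s : ℝ} (hs : s ∈ Icc (0 : ℝ) 1)
    (e : (i + s) / m = 0) : i = 0 ∧ s = 0 := by
  have hm' : (m : ℝ) ≠ 0 := by positivity
  have hsum : (i : ℝ) + s = 0 := by simpa [hm'] using e
  have hi₀ : (i : ℝ) = 0 := by linarith [hs.1, Nat.cast_nonneg (α := ℝ) i]
  exact ⟨by exact_mod_cast hi₀, by linarith⟩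

theorem eq_one_of_add_div {i : ℕ} (hi : i < m) {s : ℝ} (hs : s ∈ Icc (0 : ℝ) 1)
    (e : (i + s) / m = 1) : i = m - 1 ∧ s = 1 := by
  have hm' : (m : ℝ) ≠ 0 := by have := hi.pos; positivity
  have hsum : (i : ℝ) + s = m := by rwa [div_eq_one_iff_eq hm'] at e
  have hle : (i : ℝ) + 1 ≤ m := by exact_mod_cast hi
  have hm₁ : (m : ℝ) = (i + 1 : ℕ) := by push_cast; linarith [hs.2]
  have : m = i + 1 := by exact_mod_cast hm₁
  exact ⟨by omega, by linarith [hs.2]⟩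

theorem mem_whiteUnion_swap (n : ℕ) :
    z.swap ∈ whiteUnion m (Prod.swap ⁻¹' w) n ↔ z ∈ whiteUnion m w n := by
  induction n generalizing z with
  | zero => simp [whiteUnion, unitSq]
  | succ n ih =>
    rw [mem_whiteUnion_succ, mem_whiteUnion_succ]
    constructor
    · rintro ⟨a, ha, z', hz', e⟩
      exact ⟨a.swap, ha, z'.swap, ih.1 hz', congrArg Prod.swap e⟩
    · rintro ⟨a, ha, z', hz', rfl⟩
      exact ⟨a.swap, ha, z'.swap, ih.2 hz', rfl⟩

namespace IsPattern

theorem m_pos (h : IsPattern m w c r) : 0 < m := by have := h.c_lt; omega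

theorem whiteUnion_subset (h : IsPattern m w c r) (n : ℕ) : whiteUnion m w n ⊆ unitSq := by
  cases n with
  | zero => exact subset_rfl
  | succ n =>
    intro z hz
    obtain ⟨a, ha, z', hz', rfl⟩ := mem_whiteUnion_succ.1 hz
    exact cellMap_mem (h.lt a ha).1 (h.lt a ha).2 (h.whiteUnion_subset n hz')

theorem whiteUnion_succ_subset (h : IsPattern m w c r) (n : ℕ) :
    whiteUnion m w (n + 1) ⊆ whiteUnion m w n := by
  induction n with
  | zero => exact h.whiteUnion_subset 1
  | succ n ih => exact iUnion₂_mono fun a _ => image_mono ih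

theorem isCompact_whiteUnion (h : IsPattern m w c r) (n : ℕ) : IsCompact (whiteUnion m w n) := by
  induction n with
  | zero => exact isCompact_Icc.prod isCompact_Icc
  | succ n ih =>
    have := h.finite
    exact (toFinite w).isCompact_biUnion fun a _ => ih.image (continuous_cellMap m a)

theorem left_mem_iff (h : IsPattern m w c r) (n : ℕ) (t : ℝ) :
    (0, t) ∈ whiteUnion m w n ↔ (1, t) ∈ whiteUnion m w n := by
  have hm := h.m_pos
  induction n generalizing t with
  | zero => simp [whiteUnion, unitSq]
  | succ n ih =>
    rw [mem_whiteUnion_succ, mem_whiteUnion_succ]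
    constructor
    · rintro ⟨⟨i, j⟩, ha, ⟨s, s'⟩, hz, e⟩
      obtain ⟨e₁, rfl⟩ := Prod.mk.inj e
      obtain ⟨rfl, rfl⟩ := eq_zero_of_add_div hm (h.whiteUnion_subset n hz).1 e₁
      exact ⟨(m - 1, j), (h.right j).2 ((h.left j).1 ha), (1, s'), (ih s').1 hz,
        cellMap_right hm j s'⟩
    · rintro ⟨⟨i, j⟩, ha, ⟨s, s'⟩, hz, e⟩
      obtain ⟨e₁, rfl⟩ := Prod.mk.inj e
      obtain ⟨rfl, rfl⟩ := eq_one_of_add_div (h.lt _ ha).1 (h.whiteUnion_subset n hz).1 e₁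
      exact ⟨(0, j), (h.left j).2 ((h.right j).1 ha), (0, s'), (ih s').2 hz, cellMap_left m j s'⟩

theorem bottom_mem_iff (h : IsPattern m w c r) (n : ℕ) (t : ℝ) :
    (t, 0) ∈ whiteUnion m w n ↔ (t, 1) ∈ whiteUnion m w n := by
  rw [← mem_whiteUnion_swap, ← mem_whiteUnion_swap (z := (t, 1))]
  exact h.swap.left_mem_iff n t

theorem notMem_of_corner (h : IsPattern m w c r) (hz₁ : z.1 = 0 ∨ z.1 = 1)
    (hz₂ : z.2 = 0 ∨ z.2 = 1) (n : ℕ) : z ∉ whiteUnion m w (n + 1) := by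
  rw [mem_whiteUnion_succ]
  rintro ⟨⟨i, j⟩, ha, z', hz', rfl⟩
  have hz'' := h.whiteUnion_subset n hz'
  have hlt := h.lt _ ha
  have hi : i = 0 ∨ i = m - 1 :=
    hz₁.imp (fun e => (eq_zero_of_add_div h.m_pos hz''.1 e).1)
      fun e => (eq_one_of_add_div hlt.1 hz''.1 e).1
  have hj : j = 0 ∨ j = m - 1 :=
    hz₂.imp (fun e => (eq_zero_of_add_div h.m_pos hz''.2 e).1)
      fun e => (eq_one_of_add_div hlt.2 hz''.2 e).1
  have hic : i = c := by
    rcases hj with rfl | rfl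
    · exact (h.bottom i).1 ha
    · exact (h.top i).1 ha
  have := h.c_pos
  have := h.c_lt
  omega

theorem cellMap_mem_whiteUnion_succ_iff (h : IsPattern m w c r) (ha : a ∈ w) (hz : z ∈ unitSq)
    (n : ℕ) : cellMap m a z ∈ whiteUnion m w (n + 1) ↔ z ∈ whiteUnion m w n := by
  refine ⟨fun hmem => ?_, fun hz => mem_whiteUnion_succ.2 ⟨a, ha, z, hz, rfl⟩⟩
  obtain ⟨b, -, z', hz', e⟩ := mem_whiteUnion_succ.1 hmem
  cases n with
  | zero => exact hz
  | succ n =>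
    -- The two cells agree, are neighbours (use the symmetry of the sides) or meet in a corner.
    obtain ⟨e₁, e₂⟩ := (cellMap_eq_cellMap_iff h.m_pos).1 e
    have hz'' := h.whiteUnion_subset _ hz'
    obtain ⟨x, y⟩ := z
    obtain ⟨x', y'⟩ := z'
    have hx := add_eq_add_cases hz''.1 hz.1 e₁
    have hy := add_eq_add_cases hz''.2 hz.2 e₂
    simp only at hx hy
    rcases hx with ⟨-, rfl⟩ | hx
    · rcases hy with ⟨-, rfl⟩ | ⟨-, rfl, rfl⟩ | ⟨-, rfl, rfl⟩
      · exact hz'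
      · exact (h.bottom_mem_iff _ _).2 hz'
      · exact (h.bottom_mem_iff _ _).1 hz'
    rcases hy with ⟨-, rfl⟩ | hy
    · rcases hx with ⟨-, rfl, rfl⟩ | ⟨-, rfl, rfl⟩
      · exact (h.left_mem_iff _ _).2 hz'
      · exact (h.left_mem_iff _ _).1 hz'
    · exact absurd hz' (h.notMem_of_corner (by simp only; tauto) (by simp only; tauto) n)

theorem cellMap_mem_squareFractal_iff (h : IsPattern m w c r) (ha : a ∈ w) (hz : z ∈ unitSq) :
    cellMap m a z ∈ squareFractal m w ↔ z ∈ squareFractal m w := by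
  simp only [squareFractal, mem_iInter]
  refine ⟨fun h' n => (h.cellMap_mem_whiteUnion_succ_iff ha hz n).1 (h' _), fun h' n => ?_⟩
  exact h.whiteUnion_succ_subset n ((h.cellMap_mem_whiteUnion_succ_iff ha hz n).2 (h' n))

theorem latticePoint_notMem (h : IsPattern m w c r) (v : ℕ × ℕ) :
    latticePoint m v ∉ squareFractal m w := by
  intro hmem
  obtain ⟨a, -, z, hz, e⟩ := mem_whiteUnion_succ.1 (mem_iInter.1 hmem 2)
  have hv : latticePoint m v = cellMap m v 0 := by simp [latticePoint, cellMap]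
  obtain ⟨e₁, e₂⟩ := (cellMap_eq_cellMap_iff h.m_pos).1 (e.trans hv)
  have hz' := h.whiteUnion_subset _ hz
  have hx := add_eq_add_cases hz'.1 (by simp) e₁
  have hy := add_eq_add_cases hz'.2 (by simp) e₂
  simp only [Prod.fst_zero, Prod.snd_zero] at hx hy
  exact h.notMem_of_corner (by tauto) (by tauto) 0 hz

theorem corner_mem_squareComplement (h : IsPattern m w c r) (i : Fin 4) :
    corner i ∈ squareComplement m w :=
  ⟨corner_mem i, by rw [← latticePoint_gridCorner h.m_pos]; exact h.latticePoint_notMem _⟩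

theorem cellMap_notMem_of_mem_Ioo (h : IsPattern m w c r) (ha : a ∉ w)
    (hz : z ∈ Ioo (0 : ℝ) 1 ×ˢ Ioo (0 : ℝ) 1) : cellMap m a z ∉ squareFractal m w := by
  intro hmem
  obtain ⟨b, hb, z', hz', e⟩ := mem_whiteUnion_succ.1 (mem_iInter.1 hmem 1)
  obtain ⟨e₁, e₂⟩ := (cellMap_eq_cellMap_iff h.m_pos).1 e
  have heq {i j : ℕ} {s t : ℝ} (hs : s ∈ Icc (0 : ℝ) 1) (ht : t ∈ Ioo (0 : ℝ) 1)
      (e : (i : ℝ) + s = j + t) : i = j := by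
    rcases add_eq_add_cases hs (Ioo_subset_Icc_self ht) e with h | h | h
    · exact h.1
    · exact absurd h.2.2 ht.1.ne'
    · exact absurd h.2.2 ht.2.ne
  exact ha (Prod.ext (heq hz'.1 hz.1 e₁) (heq hz'.2 hz.2 e₂) ▸ hb)

theorem isPreconnected_black (h : IsPattern m w c r) (ha : a ∉ w) :
    IsPreconnected (cellMap m a '' unitSq \ squareFractal m w) := by
  have hconv : Convex ℝ (Ioo (0 : ℝ) 1 ×ˢ Ioo (0 : ℝ) 1) := (convex_Ioo 0 1).prod (convex_Ioo 0 1)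
  have hcont := continuous_cellMap m a
  refine (hconv.isPreconnected.image (cellMap m a) hcont.continuousOn).subset_closure ?_ ?_
  · rintro _ ⟨z, hz, rfl⟩
    exact ⟨mem_image_of_mem _ ⟨Ioo_subset_Icc_self hz.1, Ioo_subset_Icc_self hz.2⟩,
      h.cellMap_notMem_of_mem_Ioo ha hz⟩
  · refine sdiff_subset.trans (Subset.trans ?_ (image_closure_subset_closure_image hcont))
    rw [closure_prod_eq, closure_Ioo zero_ne_one, unitSq]

theorem connectedComponentIn_eq_of_black (h : IsPattern m w c r) (ha₁ : a.1 < m) (ha₂ : a.2 < m)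
    (ha : a ∉ w) (hz : z ∈ cellMap m a '' unitSq \ squareFractal m w)
    (hz' : z' ∈ cellMap m a '' unitSq \ squareFractal m w) :
    connectedComponentIn (squareComplement m w) z =
      connectedComponentIn (squareComplement m w) z' := by
  refine connectedComponentIn_eq ((h.isPreconnected_black ha).subset_connectedComponentIn hz ?_ hz')
  exact sdiff_subset_sdiff_left (image_subset_iff.2 fun _ => cellMap_mem ha₁ ha₂)

theorem vertex_mem_cell (h : IsPattern m w c r) (a : ℕ × ℕ) (i : Fin 4) :
    latticePoint m (vertex a i) ∈ cellMap m a '' unitSq \ squareFractal m w :=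
  ⟨⟨corner i, corner_mem i, cellMap_corner m a i⟩, h.latticePoint_notMem _⟩

theorem exists_corner_mem_of_latticePoint (h : IsPattern m w c r) {v : ℕ × ℕ} (hv₁ : v.1 ≤ m)
    (hv₂ : v.2 ≤ m) :
    ∃ k, corner k ∈ connectedComponentIn (squareComplement m w) (latticePoint m v) := by
  refine h.mem_of_constantOnBlack (C := {v | ∃ k, corner k ∈
    connectedComponentIn (squareComplement m w) (latticePoint m v)}) ?_ (fun i => ⟨i, ?_⟩) hv₁ hv₂
  · intro a ha₁ ha₂ ha i j
    rw [mem_ofPred_eq, mem_ofPred_eq, h.connectedComponentIn_eq_of_black ha₁ ha₂ ha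
      (h.vertex_mem_cell a i) (h.vertex_mem_cell a j)]
  · rw [latticePoint_gridCorner h.m_pos]
    exact mem_connectedComponentIn (h.corner_mem_squareComplement i)

theorem cellMap_mem_connectedComponentIn (h : IsPattern m w c r) (ha : a ∈ w)
    (hz : z ∈ squareComplement m w)
    (hz' : z' ∈ connectedComponentIn (squareComplement m w) z) :
    cellMap m a z' ∈ connectedComponentIn (squareComplement m w) (cellMap m a z) := by
  refine (isPreconnected_connectedComponentIn.image (cellMap m a)
    (continuous_cellMap m a).continuousOn).subset_connectedComponentIn
    (mem_image_of_mem _ (mem_connectedComponentIn hz)) ?_ (mem_image_of_mem _ hz')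
  rintro _ ⟨y, hy, rfl⟩
  have hy' := connectedComponentIn_subset _ _ hy
  exact ⟨cellMap_mem (h.lt a ha).1 (h.lt a ha).2 hy'.1,
    fun hK => hy'.2 ((h.cellMap_mem_squareFractal_iff ha hy'.1).1 hK)⟩

theorem exists_corner_mem_of_notMem (h : IsPattern m w c r) (n : ℕ) (hz : z ∈ unitSq)
    (hn : z ∉ whiteUnion m w n) :
    ∃ k, corner k ∈ connectedComponentIn (squareComplement m w) z := by
  induction n generalizing z with
  | zero => exact absurd hz hn
  | succ n ih =>
    obtain ⟨a, ha₁, ha₂, z', hz', rfl⟩ := exists_cellMap_eq h.m_pos hz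
    have hvertex (i : Fin 4) := h.exists_corner_mem_of_latticePoint (vertex_le ha₁ ha₂ i).1
      (vertex_le ha₁ ha₂ i).2
    by_cases ha : a ∈ w
    · have hn' : z' ∉ whiteUnion m w n := by
        rwa [← h.cellMap_mem_whiteUnion_succ_iff ha hz' n]
      obtain ⟨k, hk⟩ := ih hz' hn'
      have hak := h.cellMap_mem_connectedComponentIn ha
        ⟨hz', fun hK => hn' (mem_iInter.1 hK n)⟩ hk
      rw [connectedComponentIn_eq hak, cellMap_corner]
      exact hvertex k
    · rw [h.connectedComponentIn_eq_of_black ha₁ ha₂ ha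
        ⟨mem_image_of_mem _ hz', fun hK => hn (mem_iInter.1 hK _)⟩ (h.vertex_mem_cell a 0)]
      exact hvertex 0

theorem exists_corner_mem_connectedComponentIn (h : IsPattern m w c r)
    (hz : z ∈ squareComplement m w) :
    ∃ k, corner k ∈ connectedComponentIn (squareComplement m w) z := by
  obtain ⟨n, hn⟩ : ∃ n, z ∉ whiteUnion m w n := by
    simpa only [squareFractal, mem_iInter, not_forall] using hz.2
  exact h.exists_corner_mem_of_notMem n hz.1 hn

end IsPattern

end

/-! ### Separating the corners -/

section

open Set

theorem continuousOn_of_finite_closed_cover {X Y ι : Type*} [TopologicalSpace X]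
    [TopologicalSpace Y] [Finite ι] {g : X → Y} {s : Set X} {K : ι → Set X}
    (hK : ∀ i, IsClosed (K i)) (hs : s ⊆ ⋃ i, K i) (hg : ∀ i, ContinuousOn g (K i ∩ s)) :
    ContinuousOn g s := by
  rw [continuousOn_iff_continuous_domRestrict]
  refine (locallyFinite_of_finite fun i => ((↑) : s → X) ⁻¹' K i).continuous ?_
    (fun i => (hK i).preimage continuous_subtype_val) fun i => ?_
  · rw [← preimage_iUnion]
    exact eq_univ_of_forall fun x => hs x.2
  · exact (hg i).comp continuous_subtype_val.continuousOn fun x hx => ⟨hx, x.2⟩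

variable {m c r n : ℕ} {a b : ℕ × ℕ} {w : Set (ℕ × ℕ)} {z z' : ℝ × ℝ} {ℓ : ℕ × ℕ → Fin 4}

open Classical in
/-- The corner of the unit square to which the point `z` outside the white cells of order `n` is
connected: `z` is connected to a vertex of its cell, and the label of that vertex is given by `ℓ`.
The value is irrelevant at other points. -/
noncomputable def label (m : ℕ) (w : Set (ℕ × ℕ)) (ℓ : ℕ × ℕ → Fin 4) : ℕ → ℝ × ℝ → Fin 4
  | 0, _ => 0
  | n + 1, z => ℓ (vertex (cellOf m z)
      (if cellOf m z ∈ w then label m w ℓ n (cellInv m (cellOf m z) z) else 0))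

open Classical in
/-- The label of order `n + 1` of the point `cellMap m a z`, computed in the cell `a`. -/
noncomputable def cellLabel (m : ℕ) (w : Set (ℕ × ℕ)) (ℓ : ℕ × ℕ → Fin 4) (n : ℕ) (a : ℕ × ℕ)
    (z : ℝ × ℝ) : Fin 4 :=
  ℓ (vertex a (if a ∈ w then label m w ℓ n z else 0))

theorem label_succ (z : ℝ × ℝ) : label m w ℓ (n + 1) z =
    cellLabel m w ℓ n (cellOf m z) (cellInv m (cellOf m z) z) := rfl

theorem cellLabel_of_mem (ha : a ∈ w) : cellLabel m w ℓ n a z = ℓ (vertex a (label m w ℓ n z)) := by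
  rw [cellLabel, if_pos ha]

theorem IsLabelling.cellLabel_of_notMem (hℓ : IsLabelling m w ℓ) (ha₁ : a.1 < m) (ha₂ : a.2 < m)
    (ha : a ∉ w) (e : Fin 4) : cellLabel m w ℓ n a z = ℓ (vertex a e) :=
  hℓ.black a ha₁ ha₂ ha _ _

theorem cellLabel_swap_of_label_swap
    (h : label m (Prod.swap ⁻¹' w) (fun v => -ℓ v.swap) n z.swap = -label m w ℓ n z) :
    cellLabel m (Prod.swap ⁻¹' w) (fun v => -ℓ v.swap) n a.swap z.swap =
      -cellLabel m w ℓ n a z := by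
  by_cases ha : a ∈ w
  · rw [cellLabel_of_mem ha, cellLabel_of_mem (mem_preimage.2 (by rwa [Prod.swap_swap])), h,
      vertex_swap, Prod.swap_swap]
  · rw [cellLabel, cellLabel, if_neg ha, if_neg (by rwa [mem_preimage, Prod.swap_swap]),
      ← neg_zero, vertex_swap, Prod.swap_swap, neg_zero]

theorem label_swap (n : ℕ) (z : ℝ × ℝ) :
    label m (Prod.swap ⁻¹' w) (fun v => -ℓ v.swap) n z.swap = -label m w ℓ n z := by
  induction n generalizing z with
  | zero => simp [label]
  | succ n ih =>
    rw [label_succ, label_succ]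
    exact cellLabel_swap_of_label_swap (a := cellOf m z) (ih (cellInv m (cellOf m z) z))

/-- The labels of order `n` on opposite sides of the unit square are symmetric. -/
structure SideLabels (m : ℕ) (w : Set (ℕ × ℕ)) (ℓ : ℕ × ℕ → Fin 4) (n : ℕ) : Prop where
  left_right : ∀ t ∈ Icc (0 : ℝ) 1, (0, t) ∉ whiteUnion m w n →
    (label m w ℓ n (0, t) = 0 ∨ label m w ℓ n (0, t) = 3) ∧
      label m w ℓ n (1, t) = 1 - label m w ℓ n (0, t)
  bottom_top : ∀ t ∈ Icc (0 : ℝ) 1, (t, 0) ∉ whiteUnion m w n →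
    (label m w ℓ n (t, 0) = 0 ∨ label m w ℓ n (t, 0) = 1) ∧
      label m w ℓ n (t, 1) = 3 - label m w ℓ n (t, 0)

theorem SideLabels.swap (h : SideLabels m w ℓ n) :
    SideLabels m (Prod.swap ⁻¹' w) (fun v => -ℓ v.swap) n where
  left_right t ht hn := by
    have := h.bottom_top t ht (mt (mem_whiteUnion_swap (z := (t, 0)) n).2 hn)
    have h₀ : label m (Prod.swap ⁻¹' w) (fun v => -ℓ v.swap) n (0, t) = _ := label_swap n (t, 0)
    have h₁ : label m (Prod.swap ⁻¹' w) (fun v => -ℓ v.swap) n (1, t) = _ := label_swap n (t, 1)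
    rw [h₀, h₁]
    clear h₀ h₁
    generalize label m w ℓ n (t, 0) = p at *
    generalize label m w ℓ n (t, 1) = q at *
    revert p q; decide
  bottom_top t ht hn := by
    have := h.left_right t ht (mt (mem_whiteUnion_swap (z := (0, t)) n).2 hn)
    have h₀ : label m (Prod.swap ⁻¹' w) (fun v => -ℓ v.swap) n (t, 0) = _ := label_swap n (0, t)
    have h₁ : label m (Prod.swap ⁻¹' w) (fun v => -ℓ v.swap) n (t, 1) = _ := label_swap n (1, t)
    rw [h₀, h₁]
    clear h₀ h₁
    generalize label m w ℓ n (0, t) = p at *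
    generalize label m w ℓ n (1, t) = q at *
    revert p q; decide

theorem SideLabels.exists_cellLabel_eq (hs : SideLabels m w ℓ n) (hℓ : IsLabelling m w ℓ)
    (ha₁ : a.1 < m) (ha₂ : a.2 < m) (hb₁ : b.1 < m) (hb₂ : b.2 < m) {t : ℝ}
    (ht : t ∈ Icc (0 : ℝ) 1) (hab : a ∈ w ∨ b ∈ w → (0, t) ∉ whiteUnion m w n) :
    ∃ e : Fin 4, (e = 0 ∨ e = 3) ∧ cellLabel m w ℓ n a (1, t) = ℓ (vertex a (1 - e)) ∧
      cellLabel m w ℓ n b (0, t) = ℓ (vertex b e) := by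
  by_cases hn : (0, t) ∈ whiteUnion m w n
  · have hw : a ∉ w ∧ b ∉ w := not_or.1 fun hw => hab hw hn
    exact ⟨0, .inl rfl, hℓ.cellLabel_of_notMem ha₁ ha₂ hw.1 _,
      hℓ.cellLabel_of_notMem hb₁ hb₂ hw.2 _⟩
  · obtain ⟨he, he'⟩ := hs.left_right t ht hn
    refine ⟨label m w ℓ n (0, t), he, ?_, ?_⟩
    · by_cases ha : a ∈ w
      · rw [cellLabel_of_mem ha, he']
      · exact hℓ.cellLabel_of_notMem ha₁ ha₂ ha _
    · by_cases hb : b ∈ w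
      · rw [cellLabel_of_mem hb]
      · exact hℓ.cellLabel_of_notMem hb₁ hb₂ hb _

theorem notMem_of_cellMap_notMem (ha : a ∈ w) (hn : cellMap m a z ∉ whiteUnion m w (n + 1)) :
    z ∉ whiteUnion m w n :=
  fun hz => hn (mem_whiteUnion_succ.2 ⟨a, ha, z, hz, rfl⟩)

namespace IsPattern

theorem cellLabel_right_eq (h : IsPattern m w c r) (hℓ : IsLabelling m w ℓ)
    (hs : SideLabels m w ℓ n) {i j : ℕ} (hi : i + 1 < m) (hj : j < m) {t : ℝ}
    (ht : t ∈ Icc (0 : ℝ) 1) (hn : cellMap m (i, j) (1, t) ∉ whiteUnion m w (n + 1)) :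
    cellLabel m w ℓ n (i, j) (1, t) = cellLabel m w ℓ n (i + 1, j) (0, t) := by
  obtain ⟨e, he, ha, hb⟩ := hs.exists_cellLabel_eq (a := (i, j)) (b := (i + 1, j)) hℓ
    (by simp only; omega) hj hi hj ht <| by
      rintro (hw | hw)
      · rw [h.left_mem_iff]
        exact notMem_of_cellMap_notMem hw hn
      · refine notMem_of_cellMap_notMem (m := m) hw ?_
        simpa [cellMap] using hn
  rw [ha, hb]
  rcases he with rfl | rfl <;> rfl

theorem cellLabel_top_eq (h : IsPattern m w c r) (hℓ : IsLabelling m w ℓ)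
    (hs : SideLabels m w ℓ n) {i j : ℕ} (hi : i < m) (hj : j + 1 < m) {t : ℝ}
    (ht : t ∈ Icc (0 : ℝ) 1) (hn : cellMap m (i, j) (t, 1) ∉ whiteUnion m w (n + 1)) :
    cellLabel m w ℓ n (i, j) (t, 1) = cellLabel m w ℓ n (i, j + 1) (t, 0) := by
  have := h.swap.cellLabel_right_eq hℓ.swap hs.swap hj hi ht
    (mt (mem_whiteUnion_swap (z := cellMap m (i, j) (t, 1)) _).1 hn)
  rw [← neg_inj, ← cellLabel_swap_of_label_swap (label_swap n _),
    ← cellLabel_swap_of_label_swap (label_swap n _)]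
  exact this

theorem cellLabel_congr (h : IsPattern m w c r) (hℓ : IsLabelling m w ℓ)
    (hs : SideLabels m w ℓ n) (ha : a.1 < m ∧ a.2 < m) (hb : b.1 < m ∧ b.2 < m)
    (hz : z ∈ unitSq) (hz' : z' ∈ unitSq) (e : cellMap m a z = cellMap m b z')
    (hn : cellMap m a z ∉ whiteUnion m w (n + 1)) :
    cellLabel m w ℓ n a z = cellLabel m w ℓ n b z' := by
  obtain ⟨i, j⟩ := a
  obtain ⟨i', j'⟩ := b
  obtain ⟨s, t⟩ := z
  obtain ⟨s', t'⟩ := z'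
  obtain ⟨e₁, e₂⟩ := (cellMap_eq_cellMap_iff h.m_pos).1 e
  simp only at e₁ e₂ ha hb
  have hmid : cellMap m (i, j) (s, t) = cellMap m (i', j) (s', t) := by
    simp only [cellMap, e₁]
  trans cellLabel m w ℓ n (i', j) (s', t)
  · obtain ⟨rfl, rfl⟩ | ⟨rfl, rfl, rfl⟩ | ⟨rfl, rfl, rfl⟩ := add_eq_add_cases hz.1 hz'.1 e₁
    · rfl
    · exact h.cellLabel_right_eq hℓ hs hb.1 ha.2 hz.2 hn
    · rw [hmid] at hn
      exact (h.cellLabel_right_eq hℓ hs ha.1 ha.2 hz.2 hn).symm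
  · obtain ⟨rfl, rfl⟩ | ⟨rfl, rfl, rfl⟩ | ⟨rfl, rfl, rfl⟩ := add_eq_add_cases hz.2 hz'.2 e₂
    · rfl
    · rw [hmid] at hn
      exact h.cellLabel_top_eq hℓ hs hb.1 hb.2 hz'.1 hn
    · rw [e] at hn
      exact (h.cellLabel_top_eq hℓ hs hb.1 ha.2 hz'.1 hn).symm

theorem label_cellMap (h : IsPattern m w c r) (hℓ : IsLabelling m w ℓ) (hs : SideLabels m w ℓ n)
    (ha₁ : a.1 < m) (ha₂ : a.2 < m) (hz : z ∈ unitSq)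
    (hn : cellMap m a z ∉ whiteUnion m w (n + 1)) :
    label m w ℓ (n + 1) (cellMap m a z) = cellLabel m w ℓ n a z :=
  have hm := h.m_pos
  (h.cellLabel_congr hℓ hs ⟨ha₁, ha₂⟩ ⟨digit_lt hm _, digit_lt hm _⟩ hz
    (cellInv_cellOf_mem hm (cellMap_mem ha₁ ha₂ hz)) (cellMap_cellInv hm _ _).symm hn).symm

theorem left_right_label_succ (h : IsPattern m w c r) (hℓ : IsLabelling m w ℓ)
    (hs : SideLabels m w ℓ n) {t : ℝ} (ht : t ∈ Icc (0 : ℝ) 1)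
    (h₀ : (0, t) ∉ whiteUnion m w (n + 1)) :
    (label m w ℓ (n + 1) (0, t) = 0 ∨ label m w ℓ (n + 1) (0, t) = 3) ∧
      label m w ℓ (n + 1) (1, t) = 1 - label m w ℓ (n + 1) (0, t) := by
  have hm := h.m_pos
  obtain ⟨⟨i, j⟩, -, hj, ⟨s', s⟩, hs', ez⟩ := exists_cellMap_eq (z := (0, t)) hm ⟨by simp, ht⟩
  obtain ⟨ei, rfl⟩ := Prod.mk.inj ez
  obtain ⟨rfl, rfl⟩ := eq_zero_of_add_div hm hs'.1 ei
  simp only at hj hs' h₀ ⊢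
  have h₁ := mt (h.left_mem_iff (n + 1) _).2 h₀
  rw [← cellMap_left] at h₀ ⊢
  rw [← cellMap_right hm] at h₁ ⊢
  rw [h.label_cellMap hℓ hs hm hj hs' h₀,
    h.label_cellMap (a := (m - 1, j)) (z := (1, s)) hℓ hs (Nat.sub_one_lt_of_lt hm) hj
      ⟨by simp, hs'.2⟩ h₁]
  obtain ⟨e, he, hr, hl⟩ := hs.exists_cellLabel_eq (a := (m - 1, j)) (b := (0, j)) hℓ
    (Nat.sub_one_lt_of_lt hm) hj hm hj hs'.2 fun hw =>
      notMem_of_cellMap_notMem ((h.left j).2 (hw.elim (h.right j).1 (h.left j).1)) h₀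
  rw [hl, hr]
  have hm₁ : m - 1 + 1 = m := Nat.sub_add_cancel hm
  rcases he with rfl | rfl
  · simpa [vertex, hm₁] using hℓ.left_right j hj.le
  · simpa [vertex, hm₁] using hℓ.left_right (j + 1) hj

theorem sideLabels (h : IsPattern m w c r) (hℓ : IsLabelling m w ℓ) (n : ℕ) :
    SideLabels m w ℓ n := by
  induction n with
  | zero =>
    exact ⟨fun t ht hn => absurd ⟨by simp, ht⟩ hn, fun t ht hn => absurd ⟨ht, by simp⟩ hn⟩
  | succ n ih =>
    refine ⟨fun t ht => h.left_right_label_succ hℓ ih ht, fun t ht hn => ?_⟩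
    have := h.swap.left_right_label_succ hℓ.swap ih.swap ht
      (mt (mem_whiteUnion_swap (z := (t, 0)) _).1 hn)
    have h₀ : label m (Prod.swap ⁻¹' w) (fun v => -ℓ v.swap) (n + 1) (0, t) = _ :=
      label_swap (n + 1) (t, 0)
    have h₁ : label m (Prod.swap ⁻¹' w) (fun v => -ℓ v.swap) (n + 1) (1, t) = _ :=
      label_swap (n + 1) (t, 1)
    rw [h₀, h₁] at this
    clear h₀ h₁
    generalize label m w ℓ (n + 1) (t, 0) = p at *
    generalize label m w ℓ (n + 1) (t, 1) = q at *
    revert p q; decide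

theorem continuousOn_label (h : IsPattern m w c r) (hℓ : IsLabelling m w ℓ) (n : ℕ) :
    ContinuousOn (label m w ℓ n) (unitSq \ whiteUnion m w n) := by
  have hm := h.m_pos
  induction n with
  | zero => simp [whiteUnion]
  | succ n ih =>
    refine continuousOn_of_finite_closed_cover (ι := Fin m × Fin m)
      (K := fun a => cellMap m (a.1, a.2) '' unitSq) (fun a => ?_) ?_ ?_
    · exact ((isCompact_Icc.prod isCompact_Icc).image (continuous_cellMap m _)).isClosed
    · rintro z ⟨hz, -⟩
      obtain ⟨a, ha₁, ha₂, z', hz', e⟩ := exists_cellMap_eq hm hz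
      exact mem_iUnion.2 ⟨(⟨a.1, ha₁⟩, ⟨a.2, ha₂⟩), z', hz', e⟩
    rintro ⟨i, j⟩
    have hlabel : EqOn (label m w ℓ (n + 1)) (cellLabel m w ℓ n (i, j) ∘ cellInv m (i, j))
        (cellMap m (i, j) '' unitSq ∩ (unitSq \ whiteUnion m w (n + 1))) := by
      rintro _ ⟨⟨z, hz, rfl⟩, -, hn⟩
      rw [h.label_cellMap hℓ (h.sideLabels hℓ n) i.2 j.2 hz hn, Function.comp, cellInv_cellMap hm]
    refine ContinuousOn.congr ?_ hlabel
    by_cases ha : ((i : ℕ), (j : ℕ)) ∈ w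
    · have hcell : cellLabel m w ℓ n (i, j) = (fun e => ℓ (vertex (i, j) e)) ∘ label m w ℓ n :=
        funext fun _ => cellLabel_of_mem ha
      rw [hcell]
      refine (continuous_of_discreteTopology.comp_continuousOn ih).comp
        (continuous_cellInv m _).continuousOn ?_
      rintro _ ⟨⟨z, hz, rfl⟩, -, hn⟩
      rw [cellInv_cellMap hm]
      exact ⟨hz, notMem_of_cellMap_notMem ha hn⟩
    · exact continuousOn_const.congr fun z _ => hℓ.cellLabel_of_notMem i.2 j.2 ha 0

theorem label_eq_of_le (h : IsPattern m w c r) {k : ℕ} (hnk : n ≤ k) (hz : z ∈ unitSq)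
    (hn : z ∉ whiteUnion m w n) : label m w ℓ k z = label m w ℓ n z := by
  have hm := h.m_pos
  induction n generalizing z k with
  | zero => exact absurd hz hn
  | succ n ih =>
    obtain ⟨k, rfl⟩ : ∃ k', k = k' + 1 := ⟨k - 1, by omega⟩
    rw [label_succ, label_succ, cellLabel, cellLabel]
    split_ifs with ha
    · rw [← cellMap_cellInv hm (cellOf m z) z] at hn
      rw [ih (by omega) (cellInv_cellOf_mem hm hz) (notMem_of_cellMap_notMem ha hn)]
    · rfl

theorem label_corner (h : IsPattern m w c r) (hℓ : IsLabelling m w ℓ) (i : Fin 4) :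
    label m w ℓ 1 (corner i) = i := by
  have hs := h.sideLabels hℓ 1
  have hleft (t : ℝ) (ht : t = 0 ∨ t = 1) := hs.left_right t (by rcases ht with rfl | rfl <;> simp)
    (h.notMem_of_corner (.inl rfl) ht 0)
  have hleft₀ := hleft 0 (.inl rfl)
  have hleft₁ := hleft 1 (.inr rfl)
  have hbot := hs.bottom_top 0 (by simp) (h.notMem_of_corner (.inl rfl) (.inl rfl) 0)
  have h₀ : label m w ℓ 1 (0, 0) = 0 := by
    rcases hleft₀.1 with h₀ | h₀
    · exact h₀
    · simp [h₀] at hbot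
  fin_cases i
  · exact h₀
  · exact hleft₀.2.trans (by simp [h₀])
  · exact hleft₁.2.trans (by rw [hbot.2, h₀]; rfl)
  · exact hbot.2.trans (by simp [h₀])

theorem exists_continuousOn_corner (h : IsPattern m w c r) :
    ∃ g : ℝ × ℝ → Fin 4, ContinuousOn g (squareComplement m w) ∧ ∀ i, g (corner i) = i := by
  obtain ⟨ℓ, hℓ⟩ := h.exists_isLabelling
  let order (z : ℝ × ℝ) : ℕ := sInf {n | z ∉ whiteUnion m w n}
  have hg {z : ℝ × ℝ} {n : ℕ} (hz : z ∈ unitSq) (hn : z ∉ whiteUnion m w n) :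
      label m w ℓ (order z) z = label m w ℓ n z :=
    (h.label_eq_of_le (Nat.sInf_le hn) hz (Nat.sInf_mem (s := {n | z ∉ _}) ⟨n, hn⟩)).symm
  refine ⟨fun z => label m w ℓ (order z) z, fun z hz => ?_, fun i => ?_⟩
  · obtain ⟨n, hn⟩ : ∃ n, z ∉ whiteUnion m w n := by
      simpa only [squareFractal, mem_iInter, not_forall] using hz.2
    have hopen := (h.isCompact_whiteUnion n).isClosed.isOpen_compl.mem_nhds hn
    have hcont := ((h.continuousOn_label hℓ n).congr fun y hy => hg hy.1 hy.2) z ⟨hz.1, hn⟩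
    refine hcont.mono_of_mem_nhdsWithin ?_
    filter_upwards [self_mem_nhdsWithin, mem_nhdsWithin_of_mem_nhds hopen] with y hy hy'
    exact ⟨hy.1, hy'⟩
  · have hn : corner i ∉ whiteUnion m w 1 :=
      h.notMem_of_corner (by fin_cases i <;> simp [corner]) (by fin_cases i <;> simp [corner]) 0
    exact (hg (corner_mem i) hn).trans (h.label_corner hℓ i)

end IsPattern

end

/-! ### Quadrilaterals as images of the unit square -/

section

open Set

variable {m : ℕ} {z : ℝ × ℝ} {Q R : Quad} {x u v : Plane} {α β : Fin 4 → ℝ}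

/-- The coordinates `α` with `α₂ = 0` or `α₄ = 0` of the point `z` of the unit square with respect
to its four corners. -/
noncomputable def bary (z : ℝ × ℝ) : Fin 4 → ℝ :=
  ![1 - max z.1 z.2, max (z.1 - z.2) 0, min z.1 z.2, max (z.2 - z.1) 0]

/-- The map from the unit square onto the quadrilateral `R` that is affine on both sides of the
diagonal and respects the vertices. -/
noncomputable def quadMap (R : Quad) (z : ℝ × ℝ) : Plane := ∑ i, bary z i • R i

theorem bary_lower (h : z.2 ≤ z.1) : bary z = ![1 - z.1, z.1 - z.2, z.2, 0] := by
  simp [bary, h]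

theorem bary_upper (h : z.1 ≤ z.2) : bary z = ![1 - z.2, 0, z.1, z.2 - z.1] := by
  simp [bary, h]

theorem sum_bary (z : ℝ × ℝ) : ∑ i, bary z i = 1 := by
  rcases le_total z.1 z.2 with h | h
  · simp [bary_upper h, Fin.sum_univ_four]
  · simp [bary_lower h, Fin.sum_univ_four]

theorem quadMap_lower (R : Quad) (h : z.2 ≤ z.1) :
    quadMap R z = (1 - z.1) • R 0 + (z.1 - z.2) • R 1 + z.2 • R 2 := by
  simp [quadMap, bary_lower h, Fin.sum_univ_four]

theorem quadMap_upper (R : Quad) (h : z.1 ≤ z.2) :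
    quadMap R z = (1 - z.2) • R 0 + z.1 • R 2 + (z.2 - z.1) • R 3 := by
  simp [quadMap, bary_upper h, Fin.sum_univ_four]

theorem continuous_quadMap (R : Quad) : Continuous (quadMap R) := by
  have hb (i : Fin 4) : Continuous fun z => bary z i := by
    fin_cases i <;> simp only [bary, Fin.reduceFinMk, Matrix.cons_val] <;> fun_prop
  unfold quadMap
  fun_prop

theorem quadMap_corner (R : Quad) (i : Fin 4) : quadMap R (corner i) = R i := by
  fin_cases i <;> simp [quadMap, bary, corner, Fin.sum_univ_four]

theorem bary_injective : Function.Injective bary := by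
  have hinv (z : ℝ × ℝ) : (bary z 1 + bary z 2, bary z 2 + bary z 3) = z := by
    rcases le_total z.1 z.2 with h | h
    · simp [bary_upper h]
    · simp [bary_lower h]
  intro z z' e
  rw [← hinv z, e, hinv]

theorem isRep_bary (R : Quad) (hz : z ∈ unitSq) : IsRep R (quadMap R z) (bary z) := by
  obtain ⟨⟨hx₀, hx₁⟩, hy₀, hy₁⟩ := hz
  refine ⟨fun i => ?_, sum_bary z, ?_, rfl⟩
  · fin_cases i <;> simp [bary, *]
  · rcases le_total z.1 z.2 with h | h
    · exact .inl (by simp [bary_upper h])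
    · exact .inr (by simp [bary_lower h])

theorem exists_bary_eq (hα : ∀ i, 0 ≤ α i) (hsum : ∑ i, α i = 1) (hα' : α 1 = 0 ∨ α 3 = 0) :
    ∃ z ∈ unitSq, bary z = α := by
  rw [Fin.sum_univ_four] at hsum
  have h₀ := hα 0
  have h₁ := hα 1
  have h₂ := hα 2
  have h₃ := hα 3
  refine ⟨(α 1 + α 2, α 2 + α 3), ⟨⟨?_, ?_⟩, ?_, ?_⟩, ?_⟩
  iterate 4 simp only; linarith
  rcases hα' with h | h
  · rw [bary_upper (by simp only; linarith)]
    funext i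
    fin_cases i <;> simp <;> linarith
  · rw [bary_lower (by simp only; linarith)]
    funext i
    fin_cases i <;> simp <;> linarith

theorem le_of_sub_mul_eq_sub_mul {p q s s' t t' : ℝ} (hp : 0 < p) (hq : 0 ≤ q) (hs' : 0 ≤ s')
    (ht' : 0 ≤ t') (hst : s = 0 ∨ t = 0) (h : (s - s') * p = (t - t') * q) : s ≤ s' := by
  rcases hst with rfl | rfl
  · exact hs'
  · have := mul_nonneg ht' hq
    exact sub_nonpos.1 (nonpos_of_mul_nonpos_left (by linarith) hp)

theorem eq_of_sub_mul_eq_sub_mul {p q s s' t t' : ℝ} (hp : 0 < p) (hq : 0 ≤ q) (hs : 0 ≤ s)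
    (hs' : 0 ≤ s') (ht : 0 ≤ t) (ht' : 0 ≤ t') (hst : s = 0 ∨ t = 0) (hst' : s' = 0 ∨ t' = 0)
    (h : (s - s') * p = (t - t') * q) : s = s' :=
  (le_of_sub_mul_eq_sub_mul hp hq hs' ht' hst h).antisymm
    (le_of_sub_mul_eq_sub_mul hp hq hs ht hst' (by linear_combination -h))

theorem IsRep.unique (hQ : IsConvexQuad Q) (hα : IsRep Q x α) (hβ : IsRep Q x β) : α = β := by
  obtain ⟨hα₀, hα₁, hα', rfl⟩ := hα
  obtain ⟨hβ₀, hβ₁, hβ', e⟩ := hβ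
  have ex := congrArg (fun v : Plane => v 0) e
  have ey := congrArg (fun v : Plane => v 1) e
  simp only [Fin.sum_univ_four, PiLp.add_apply, PiLp.smul_apply, smul_eq_mul] at hα₁ hβ₁ ex ey
  have hp : 0 < cross (Q 1 - Q 0) (Q 2 - Q 1) := hQ 0
  have hq : 0 < cross (Q 3 - Q 2) (Q 0 - Q 3) := hQ 2
  -- The cross product of `e` with the diagonal `Q₁Q₃`.
  have hdiag : (α 1 - β 1) * cross (Q 1 - Q 0) (Q 2 - Q 1) =
      (α 3 - β 3) * cross (Q 3 - Q 2) (Q 0 - Q 3) := by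
    simp only [cross, PiLp.sub_apply]
    linear_combination (Q 2 0 - Q 0 0) * ey - (Q 2 1 - Q 0 1) * ex +
      ((Q 2 0 - Q 0 0) * Q 0 1 - (Q 2 1 - Q 0 1) * Q 0 0) * (hα₁ - hβ₁)
  have h₁ : α 1 = β 1 := eq_of_sub_mul_eq_sub_mul hp hq.le (hα₀ 1) (hβ₀ 1) (hα₀ 3) (hβ₀ 3) hα' hβ'
    hdiag
  have h₃ : α 3 = β 3 := eq_of_sub_mul_eq_sub_mul hq hp.le (hα₀ 3) (hβ₀ 3) (hα₀ 1) (hβ₀ 1)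
    hα'.symm hβ'.symm hdiag.symm
  have h₀ : α 0 = β 0 := by
    refine sub_eq_zero.1 ((mul_eq_zero.1 ?_).resolve_right hp.ne')
    rw [h₁, h₃] at ex ey hα₁
    simp only [cross, PiLp.sub_apply]
    linear_combination (Q 1 0 - Q 0 0) * ey - (Q 1 1 - Q 0 1) * ex +
      ((Q 1 0 - Q 0 0) * Q 2 1 - (Q 1 1 - Q 0 1) * Q 2 0) * (hα₁ - hβ₁)
  have h₂ : α 2 = β 2 := by linarith
  funext i
  fin_cases i <;> assumption

theorem rep_quadMap (hQ : IsConvexQuad Q) (hz : z ∈ unitSq) : rep Q (quadMap Q z) = bary z :=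
  IsRep.unique hQ (Classical.epsilon_spec ⟨_, isRep_bary Q hz⟩) (isRep_bary Q hz)

theorem P_quadMap (hQ : IsConvexQuad Q) (R : Quad) (hz : z ∈ unitSq) :
    P Q R (quadMap Q z) = quadMap R z := by
  rw [P, rep_quadMap hQ hz, quadMap]

theorem injOn_quadMap (hQ : IsConvexQuad Q) : InjOn (quadMap Q) unitSq := by
  intro z hz z' hz' e
  apply bary_injective
  rw [← rep_quadMap hQ hz, e, rep_quadMap hQ hz']

theorem cross_smul_add_cross_smul (Q : Quad) :
    cross (Q 2 - Q 1) (Q 3 - Q 2) • Q 0 + cross (Q 0 - Q 3) (Q 1 - Q 0) • Q 2 =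
      cross (Q 3 - Q 2) (Q 0 - Q 3) • Q 1 + cross (Q 1 - Q 0) (Q 2 - Q 1) • Q 3 := by
  ext i
  fin_cases i <;>
    simp only [cross, PiLp.sub_apply, PiLp.add_apply, PiLp.smul_apply, smul_eq_mul, Fin.zero_eta,
      Fin.mk_one] <;> ring

theorem isRep_of_cross {t : ℝ} (hQ : IsConvexQuad Q) (hβ : β ∈ stdSimplex ℝ (Fin 4)) (ht : 0 ≤ t)
    (h₁ : t * cross (Q 3 - Q 2) (Q 0 - Q 3) ≤ β 1) (h₃ : t * cross (Q 1 - Q 0) (Q 2 - Q 1) ≤ β 3)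
    (h : t * cross (Q 3 - Q 2) (Q 0 - Q 3) = β 1 ∨ t * cross (Q 1 - Q 0) (Q 2 - Q 1) = β 3) :
    IsRep Q (∑ i, β i • Q i) ![β 0 + t * cross (Q 2 - Q 1) (Q 3 - Q 2),
      β 1 - t * cross (Q 3 - Q 2) (Q 0 - Q 3), β 2 + t * cross (Q 0 - Q 3) (Q 1 - Q 0),
      β 3 - t * cross (Q 1 - Q 0) (Q 2 - Q 1)] := by
  obtain ⟨hβ₀, hβ₁⟩ := hβ
  rw [Fin.sum_univ_four] at hβ₁
  refine ⟨fun i => ?_, ?_, ?_, ?_⟩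
  · fin_cases i
    · exact add_nonneg (hβ₀ 0) (mul_nonneg ht (hQ 1).le)
    · exact sub_nonneg.2 h₁
    · exact add_nonneg (hβ₀ 2) (mul_nonneg ht (hQ 3).le)
    · exact sub_nonneg.2 h₃
  · simp only [Fin.sum_univ_four, Matrix.cons_val, cross, PiLp.sub_apply]
    linear_combination hβ₁
  · exact h.imp (fun h => sub_eq_zero.2 h.symm) fun h => sub_eq_zero.2 h.symm
  · simp only [Fin.sum_univ_four, Matrix.cons_val]
    linear_combination (norm := module) t • cross_smul_add_cross_smul Q

theorem exists_isRep (hQ : IsConvexQuad Q) (hβ : β ∈ stdSimplex ℝ (Fin 4)) :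
    ∃ α, IsRep Q (∑ i, β i • Q i) α := by
  have hp : 0 < cross (Q 3 - Q 2) (Q 0 - Q 3) := hQ 2
  have hq : 0 < cross (Q 1 - Q 0) (Q 2 - Q 1) := hQ 0
  rcases le_total (β 1 / cross (Q 3 - Q 2) (Q 0 - Q 3)) (β 3 / cross (Q 1 - Q 0) (Q 2 - Q 1))
    with h | h
  · have e := div_mul_cancel₀ (β 1) hp.ne'
    exact ⟨_, isRep_of_cross hQ hβ (div_nonneg (hβ.1 1) hp.le) e.le ((le_div_iff₀ hq).1 h) (.inl e)⟩
  · have e := div_mul_cancel₀ (β 3) hq.ne'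
    exact ⟨_, isRep_of_cross hQ hβ (div_nonneg (hβ.1 3) hq.le) ((le_div_iff₀ hp).1 h) e.le (.inr e)⟩

theorem carrier_eq_image (hR : IsConvexQuad R) : carrier R = quadMap R '' unitSq := by
  have hcarrier : carrier R = Fintype.linearCombination ℝ R '' stdSimplex ℝ (Fin 4) := by
    rw [carrier, ← convexHull_rangle_single_eq_stdSimplex, LinearMap.image_convexHull, ← range_comp]
    congr 2
    funext i
    simp
  rw [hcarrier]
  apply Subset.antisymm
  · rintro _ ⟨β, hβ, rfl⟩
    obtain ⟨α, hα, hsum, hα', e⟩ := exists_isRep hR hβ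
    obtain ⟨z, hz, rfl⟩ := exists_bary_eq hα hsum hα'
    exact ⟨z, hz, e⟩
  · rintro _ ⟨z, hz, rfl⟩
    exact ⟨bary z, ⟨(isRep_bary R hz).1, sum_bary z⟩, rfl⟩

theorem cross_smul_smul (s t : ℝ) (u v : Plane) : cross (s • u) (t • v) = s * t * cross u v := by
  simp only [cross, PiLp.smul_apply, smul_eq_mul]
  ring

theorem isConvexQuad_homothety {ρ : ℝ} (hQ : IsConvexQuad Q) (hρ : 0 < ρ) (x : Plane) :
    IsConvexQuad fun i => x + ρ • Q i := fun i => by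
  simp only [add_sub_add_left_eq_sub, ← smul_sub, cross_smul_smul]
  exact mul_pos (mul_pos hρ hρ) (hQ i)

theorem quadMap_homothety (Q : Quad) (x : Plane) (ρ : ℝ) (z : ℝ × ℝ) :
    quadMap (fun i => x + ρ • Q i) z = x + ρ • quadMap Q z := by
  simp only [quadMap, smul_add, Finset.sum_add_distrib, ← Finset.sum_smul, sum_bary, one_smul,
    Finset.smul_sum, smul_comm ρ]

theorem isConvexQuad_parallelogram (huv : 0 < cross u v) (x : Plane) :
    IsConvexQuad ![x, x + u, x + u + v, x + v] := fun i => by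
  simp only [cross, PiLp.sub_apply] at *
  fin_cases i <;> simp <;> linarith

theorem quadMap_parallelogram (x u v : Plane) (z : ℝ × ℝ) :
    quadMap ![x, x + u, x + u + v, x + v] z = x + z.1 • u + z.2 • v := by
  rcases le_total z.1 z.2 with h | h
  · simp only [quadMap_upper _ h, Matrix.cons_val]
    module
  · simp only [quadMap_lower _ h, Matrix.cons_val]
    module

theorem exists_quadMap_eq_quadMap_homothety (hQ : IsConvexQuad Q) {ρ s t : ℝ} (hρ : 0 < ρ)
    (hst : s = t ∨ t + ρ ≤ s ∨ s + ρ ≤ t) : ∃ R, IsConvexQuad R ∧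
      ∀ z ∈ unitSq, quadMap R z = quadMap Q (s + ρ * z.1, t + ρ * z.2) := by
  obtain rfl | hst | hst := hst
  · refine ⟨_, isConvexQuad_homothety hQ hρ ((1 - s - ρ) • Q 0 + s • Q 2), fun z _ => ?_⟩
    rw [quadMap_homothety]
    rcases le_total z.1 z.2 with h | h
    · rw [quadMap_upper _ h, quadMap_upper _ (by simp only; gcongr)]
      module
    · rw [quadMap_lower _ h, quadMap_lower _ (by simp only; gcongr)]
      module
  · refine ⟨_, isConvexQuad_parallelogram (u := ρ • (Q 1 - Q 0)) (v := ρ • (Q 2 - Q 1)) ?_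
      ((1 - s) • Q 0 + (s - t) • Q 1 + t • Q 2), fun z hz => ?_⟩
    · rw [cross_smul_smul]
      exact mul_pos (mul_pos hρ hρ) (hQ 0)
    · rw [quadMap_parallelogram, quadMap_lower _ (by simp only; nlinarith [hz.1.1, hz.2.2])]
      module
  · refine ⟨_, isConvexQuad_parallelogram (u := ρ • (Q 2 - Q 3)) (v := ρ • (Q 3 - Q 0)) ?_
      ((1 - t) • Q 0 + (t - s) • Q 3 + s • Q 2), fun z hz => ?_⟩
    · rw [← neg_sub (Q 3), ← neg_sub (Q 0), smul_neg, smul_neg, ← neg_smul, ← neg_smul,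
        cross_smul_smul]
      exact mul_pos (mul_pos_of_neg_of_neg (neg_neg_of_pos hρ) (neg_neg_of_pos hρ)) (hQ 2)
    · rw [quadMap_parallelogram, quadMap_upper _ (by simp only; nlinarith [hz.2.1, hz.1.2])]
      module

/-- The quadrilateral in `Q` that corresponds to the cell `a` of the unit square. -/
noncomputable def cellQuad (Q : Quad) (m : ℕ) (a : ℕ × ℕ) : Quad :=
  fun i => quadMap Q (cellMap m a (corner i))

theorem isConvexQuad_cellQuad_and_quadMap_eq (hQ : IsConvexQuad Q) (hm : 0 < m) (a : ℕ × ℕ) :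
    IsConvexQuad (cellQuad Q m a) ∧
      ∀ z ∈ unitSq, quadMap (cellQuad Q m a) z = quadMap Q (cellMap m a z) := by
  have hle {i j : ℕ} (hij : i < j) : (i / m + 1 / m : ℝ) ≤ j / m := by
    rw [← add_div]
    gcongr
    exact_mod_cast hij
  have hcases : (a.1 / m : ℝ) = a.2 / m ∨ (a.2 / m + 1 / m : ℝ) ≤ a.1 / m ∨
      (a.1 / m + 1 / m : ℝ) ≤ a.2 / m := by
    rcases lt_trichotomy a.1 a.2 with h | h | h
    · exact .inr (.inr (hle h))
    · exact .inl (by rw [h])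
    · exact .inr (.inl (hle h))
  obtain ⟨R, hR, e⟩ := exists_quadMap_eq_quadMap_homothety hQ (by positivity) hcases
  have hcell (z : ℝ × ℝ) : (a.1 / m + 1 / m * z.1, a.2 / m + 1 / m * z.2) = cellMap m a z := by
    simp only [cellMap]
    ring_nf
  simp only [hcell] at e
  have : cellQuad Q m a = R := by
    funext i
    rw [cellQuad, ← e _ (corner_mem i), quadMap_corner]
  rw [this]
  exact ⟨hR, e⟩

end

/-! ### The labyrinth set as a pattern of cells -/

section

open Set

variable {m c r : ℕ} {a b : ℕ × ℕ} {w : Set (ℕ × ℕ)} {Q : Quad} {W : Set Quad} {k : Fin 4 → ℕ}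

/-- The index `k ∈ A m` of the quadrilateral that corresponds to the cell `a`. -/
def cellIndex (m : ℕ) (a : ℕ × ℕ) : Fin 4 → ℕ :=
  ![m - 1 - max a.1 a.2, a.1 - a.2, min a.1 a.2, a.2 - a.1]

theorem lt_and_eq_cellIndex (hk : k ∈ A m) :
    k 1 + k 2 < m ∧ k 2 + k 3 < m ∧ k = cellIndex m (k 1 + k 2, k 2 + k 3) := by
  simp only [A, A₁, A₂, A₃, mem_union, mem_ofPred_eq] at hk
  refine ⟨by omega, by omega, ?_⟩
  funext i
  fin_cases i <;> simp only [cellIndex, Fin.reduceFinMk, Matrix.cons_val] <;> omega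

theorem cellIndex_mem (ha₁ : a.1 < m) (ha₂ : a.2 < m) : cellIndex m a ∈ A m := by
  simp only [A, A₁, A₂, A₃, mem_union, mem_ofPred_eq, cellIndex, Matrix.cons_val]
  omega

theorem gridPoint_eq (Q : Quad) (m : ℕ) (k : Fin 4 → ℕ) (e : Fin 4 → ℝ) :
    gridPoint Q m k e = ∑ i, ((k i + e i) / m) • Q i := by
  simp only [gridPoint, Finset.smul_sum, smul_smul, div_eq_inv_mul]

theorem gridPoint_lower {v : ℕ × ℕ} {e : Fin 4 → ℝ} (hm : 0 < m) (hv : v.2 ≤ v.1)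
    (h₀ : k 0 + e 0 = m - v.1) (h₁ : k 1 + e 1 = v.1 - v.2) (h₂ : k 2 + e 2 = v.2)
    (h₃ : k 3 + e 3 = 0) : gridPoint Q m k e = quadMap Q (latticePoint m v) := by
  have hm' : (m : ℝ) ≠ 0 := by positivity
  rw [gridPoint_eq, quadMap_lower Q (by simp only [latticePoint]; gcongr), Fin.sum_univ_four, h₀,
    h₁, h₂, h₃, zero_div, zero_smul, add_zero, sub_div, sub_div, div_self hm', latticePoint]

theorem gridPoint_upper {v : ℕ × ℕ} {e : Fin 4 → ℝ} (hm : 0 < m) (hv : v.1 ≤ v.2)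
    (h₀ : k 0 + e 0 = m - v.2) (h₁ : k 1 + e 1 = 0) (h₂ : k 2 + e 2 = v.1)
    (h₃ : k 3 + e 3 = v.2 - v.1) : gridPoint Q m k e = quadMap Q (latticePoint m v) := by
  have hm' : (m : ℝ) ≠ 0 := by positivity
  rw [gridPoint_eq, quadMap_upper Q (by simp only [latticePoint]; gcongr), Fin.sum_univ_four, h₀,
    h₁, h₂, h₃, zero_div, zero_smul, add_zero, sub_div, sub_div, div_self hm', latticePoint]

theorem cellIndex_lower (h : a.2 ≤ a.1) : cellIndex m a = ![m - 1 - a.1, a.1 - a.2, a.2, 0] := by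
  simp [cellIndex, h]

theorem cellIndex_upper (h : a.1 ≤ a.2) : cellIndex m a = ![m - 1 - a.2, 0, a.1, a.2 - a.1] := by
  simp [cellIndex, h]

theorem S_cellIndex (Q : Quad) (ha₁ : a.1 < m) (ha₂ : a.2 < m) :
    S Q m (cellIndex m a) = cellQuad Q m a := by
  have hm : 0 < m := by omega
  have h₁ : ((m - 1 - a.1 : ℕ) : ℝ) = m - 1 - a.1 := by
    rw [Nat.cast_sub (by omega), Nat.cast_sub hm, Nat.cast_one]
  have h₂ : ((m - 1 - a.2 : ℕ) : ℝ) = m - 1 - a.2 := by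
    rw [Nat.cast_sub (by omega), Nat.cast_sub hm, Nat.cast_one]
  funext i
  rw [cellQuad, cellMap_corner]
  rcases lt_trichotomy a.1 a.2 with h | h | h
  · rw [cellIndex_upper h.le, S, if_neg (by simp), if_pos (by simp; omega)]
    fin_cases i <;> refine gridPoint_upper hm ?_ ?_ ?_ ?_ ?_ <;>
      simp only [vertex, Fin.zero_eta, Fin.mk_one, Fin.reduceFinMk, Matrix.cons_val] <;>
      first | omega | (push_cast [h₂, Nat.cast_sub h.le]; ring)
  · rw [cellIndex_lower h.ge, S, if_neg (by simp; omega), if_neg (by simp)]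
    fin_cases i <;>
      [apply gridPoint_lower hm; apply gridPoint_lower hm; apply gridPoint_lower hm;
        apply gridPoint_upper hm] <;>
      simp only [vertex, Fin.zero_eta, Fin.mk_one, Fin.reduceFinMk, Matrix.cons_val] <;>
      first | omega | (push_cast [h, h₂, Nat.sub_self]; ring)
  · rw [cellIndex_lower h.le, S, if_pos (by simp; omega)]
    fin_cases i <;> refine gridPoint_lower hm ?_ ?_ ?_ ?_ ?_ <;>
      simp only [vertex, Fin.zero_eta, Fin.mk_one, Fin.reduceFinMk, Matrix.cons_val] <;>
      first | omega | (push_cast [h₁, Nat.cast_sub h.le]; ring)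

/-- The cells that correspond to the quadrilaterals in `W`. -/
def whiteCells (Q : Quad) (m : ℕ) (W : Set Quad) : Set (ℕ × ℕ) :=
  {a | a.1 < m ∧ a.2 < m ∧ cellQuad Q m a ∈ W}

theorem image_cellQuad_whiteCells (hW : W ⊆ grid Q m) :
    cellQuad Q m '' whiteCells Q m W = W := by
  apply Subset.antisymm
  · rintro _ ⟨a, ha, rfl⟩
    exact ha.2.2
  · intro R hR
    obtain ⟨k, hk, rfl⟩ := hW hR
    obtain ⟨h₁, h₂, h₃⟩ := lt_and_eq_cellIndex hk
    rw [h₃, S_cellIndex Q h₁ h₂] at hR ⊢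
    exact mem_image_of_mem _ ⟨h₁, h₂, hR⟩

theorem P_cellQuad (hQ : IsConvexQuad Q) (R : Quad) (ha : a ∈ whiteCells Q m W) :
    (fun i => P Q R (cellQuad Q m a i)) = cellQuad R m a :=
  funext fun i => P_quadMap hQ R (cellMap_mem ha.1 ha.2.1 (corner_mem i))

theorem white_succ (hQ : IsConvexQuad Q) (hW : W ⊆ grid Q m) (n : ℕ) :
    white Q W (n + 1) = ⋃ R ∈ white Q W n, cellQuad R m '' whiteCells Q m W := by
  ext R
  rw [mem_iUnion₂]
  constructor
  · rintro ⟨V, hV, U, hU, rfl⟩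
    rw [← image_cellQuad_whiteCells hW] at hU
    obtain ⟨a, ha, rfl⟩ := hU
    exact ⟨V, hV, a, ha, (P_cellQuad hQ V ha).symm⟩
  · rintro ⟨V, hV, a, ha, rfl⟩
    exact ⟨V, hV, _, ha.2.2, (P_cellQuad hQ V ha).symm⟩

theorem isConvexQuad_of_mem_white (hQ : IsConvexQuad Q) (hW : W ⊆ grid Q m) {n : ℕ}
    {R : Quad} (hR : R ∈ white Q W n) : IsConvexQuad R := by
  induction n generalizing R with
  | zero =>
    rw [white, ← image_cellQuad_whiteCells hW] at hR
    obtain ⟨a, ha, rfl⟩ := hR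
    exact (isConvexQuad_cellQuad_and_quadMap_eq hQ ha.1.pos a).1
  | succ n ih =>
    rw [white_succ hQ hW] at hR
    obtain ⟨V, hV, a, ha, rfl⟩ := mem_iUnion₂.1 hR
    exact (isConvexQuad_cellQuad_and_quadMap_eq (ih hV) ha.1.pos a).1

theorem iUnion_quadMap_cellQuad_image {X : Set (ℝ × ℝ)} (hQ : IsConvexQuad Q) (hm : 0 < m)
    (hX : X ⊆ unitSq) (w : Set (ℕ × ℕ)) :
    ⋃ a ∈ w, quadMap (cellQuad Q m a) '' X = quadMap Q '' ⋃ a ∈ w, cellMap m a '' X := by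
  rw [image_iUnion₂]
  refine iUnion₂_congr fun a _ => ?_
  rw [image_image]
  exact image_congr fun z hz => (isConvexQuad_cellQuad_and_quadMap_eq hQ hm a).2 z (hX hz)

theorem iUnion_white_quadMap_image (hQ : IsConvexQuad Q) (hW : W ⊆ grid Q m)
    (h : IsPattern m (whiteCells Q m W) c r) (n k : ℕ) :
    ⋃ R ∈ white Q W n, quadMap R '' whiteUnion m (whiteCells Q m W) k =
      quadMap Q '' whiteUnion m (whiteCells Q m W) (n + k + 1) := by
  have hk (k : ℕ) := h.whiteUnion_subset k
  induction n generalizing k with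
  | zero =>
    rw [zero_add, whiteUnion, ← iUnion_quadMap_cellQuad_image hQ h.m_pos (hk k),
      ← biUnion_image (f := cellQuad Q m) (g := fun R => quadMap R '' whiteUnion m _ k),
      image_cellQuad_whiteCells hW, white]
  | succ n ih =>
    rw [add_right_comm n 1 k, add_assoc n k 1, ← ih, white_succ hQ hW]
    simp only [biUnion_iUnion, biUnion_image]
    refine iUnion₂_congr fun V hV => ?_
    have hV' := isConvexQuad_of_mem_white hQ hW hV
    exact iUnion_quadMap_cellQuad_image hV' h.m_pos (hk k) _

theorem fractal_eq_image (hQ : IsConvexQuad Q) (hW : W ⊆ grid Q m)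
    (h : IsPattern m (whiteCells Q m W) c r) :
    fractal Q W = quadMap Q '' squareFractal m (whiteCells Q m W) := by
  have hshift : squareFractal m (whiteCells Q m W) =
      ⋂ n, whiteUnion m (whiteCells Q m W) (n + 1) :=
    (antitone_nat_of_succ_le h.whiteUnion_succ_subset).iInf_nat_add 1 |>.symm
  have hunion (n : ℕ) : ⋃ R ∈ white Q W n, carrier R =
      quadMap Q '' whiteUnion m (whiteCells Q m W) (n + 1) := by
    rw [← iUnion_white_quadMap_image hQ hW h n 0]
    exact iUnion₂_congr fun R hR => carrier_eq_image (isConvexQuad_of_mem_white hQ hW hR)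
  rw [hshift, fractal, iInter_congr hunion, InjOn.image_iInter_eq]
  exact (injOn_quadMap hQ).mono (iUnion_subset fun n => h.whiteUnion_subset _)

theorem carrier_diff_fractal_eq_image (hQ : IsConvexQuad Q) (hW : W ⊆ grid Q m)
    (h : IsPattern m (whiteCells Q m W) c r) :
    carrier Q \ fractal Q W = quadMap Q '' squareComplement m (whiteCells Q m W) := by
  rw [fractal_eq_image hQ hW h, carrier_eq_image hQ, squareComplement,
    (injOn_quadMap hQ).image_sdiff_subset]
  exact iInter_subset _ 0

end

/-! ### The shape of the labyrinth set -/

section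

open Set

theorem eq_or_eq_of_mem_segment {E : Type*} [AddCommGroup E] [Module ℝ E] {x y x' y' : E}
    (hx : x ∈ segment ℝ x' y') (hy : y ∈ segment ℝ x' y') (hx' : x' ∈ segment ℝ x y) :
    x' = x ∨ x' = y := by
  rw [mem_segment_iff_wbtw] at hx hy hx'
  have htotal : Wbtw ℝ x' x y ∨ Wbtw ℝ x' y x := by
    obtain ⟨s, hs, rfl⟩ := hx
    obtain ⟨t, ht, rfl⟩ := hy
    exact wbtw_or_wbtw_smul_vadd_of_nonneg x' _ hs.1 ht.1
  exact htotal.imp (fun h => h.swap_left_iff.1 hx') (fun h => h.swap_left_iff.1 hx'.symm)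

theorem eq_and_eq_or_of_segment_eq {E : Type*} [AddCommGroup E] [Module ℝ E] {x y x' y' : E}
    (h : segment ℝ x y = segment ℝ x' y') : x = x' ∧ y = y' ∨ x = y' ∧ y = x' := by
  have hx : x ∈ segment ℝ x' y' := h ▸ left_mem_segment ℝ x y
  have hy : y ∈ segment ℝ x' y' := h ▸ right_mem_segment ℝ x y
  have hx' : x' ∈ segment ℝ x y := h ▸ left_mem_segment ℝ x' y'
  have hy' : y' ∈ segment ℝ x y := h ▸ right_mem_segment ℝ x' y'
  have h₁ := eq_or_eq_of_mem_segment hx' hy' hx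
  have h₂ := eq_or_eq_of_mem_segment hx hy hx'
  rw [segment_symm ℝ x y] at hx' hy'
  rw [segment_symm ℝ x' y'] at hx hy
  have h₃ := eq_or_eq_of_mem_segment hy' hx' hy
  have h₄ := eq_or_eq_of_mem_segment hy hx hy'
  grind

variable {m c r : ℕ} {a b : ℕ × ℕ} {w : Set (ℕ × ℕ)} {Q : Quad} {W : Set Quad} {k : Fin 4 → ℕ}

theorem latticePoint_inj (hm : 0 < m) {u v : ℕ × ℕ} :
    latticePoint m u = latticePoint m v ↔ u = v := by
  have hm' : (m : ℝ) ≠ 0 := by positivity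
  simp only [latticePoint, div_left_inj' hm', Nat.cast_inj, Prod.ext_iff]

theorem cellQuad_vertex_inj (hQ : IsConvexQuad Q) (ha : a.1 < m ∧ a.2 < m)
    (hb : b.1 < m ∧ b.2 < m) (i j : Fin 4) :
    cellQuad Q m a i = cellQuad Q m b j ↔ vertex a i = vertex b j := by
  rw [cellQuad, cellQuad, (injOn_quadMap hQ).eq_iff (cellMap_mem ha.1 ha.2 (corner_mem i))
    (cellMap_mem hb.1 hb.2 (corner_mem j)), cellMap_corner, cellMap_corner,
    latticePoint_inj ha.1.pos]

theorem cellQuad_inj (hQ : IsConvexQuad Q) (ha : a.1 < m ∧ a.2 < m) (hb : b.1 < m ∧ b.2 < m) :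
    cellQuad Q m a = cellQuad Q m b ↔ a = b :=
  ⟨fun e => (cellQuad_vertex_inj hQ ha hb 0 0).1 (congrFun e 0), congrArg _⟩

theorem haveCommonSide_cellQuad_iff (hQ : IsConvexQuad Q) (ha : a.1 < m ∧ a.2 < m)
    (hb : b.1 < m ∧ b.2 < m) (hab : a ≠ b) :
    HaveCommonSide (cellQuad Q m a) (cellQuad Q m b) ↔ Neighbor a b := by
  constructor
  · rintro ⟨i, j, e⟩
    have e' := eq_and_eq_or_of_segment_eq e
    simp only [cellQuad_vertex_inj hQ ha hb] at e'
    rw [neighbor_iff]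
    rw [Ne, Prod.ext_iff] at hab
    fin_cases i <;> fin_cases j <;> simp [vertex, Prod.ext_iff] at e' <;> omega
  · rintro ⟨i, h₁, h₂⟩
    rw [← cellQuad_vertex_inj hQ ha hb] at h₁ h₂
    refine ⟨i, i + 2, ?_⟩
    rw [h₁, h₂, segment_symm, add_assoc]
    rfl

theorem isTree_cellGraph (hQ : IsConvexQuad Q) (hW : W ⊆ grid Q m)
    (htree : (whiteGraph W).IsTree) : (cellGraph (whiteCells Q m W)).IsTree := by
  have hlt (a : whiteCells Q m W) : a.1.1 < m ∧ a.1.2 < m := ⟨a.2.1, a.2.2.1⟩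
  have hbij : BijOn (cellQuad Q m) (whiteCells Q m W) W :=
    ⟨fun a ha => ha.2.2, fun a ha b hb => (cellQuad_inj hQ (hlt ⟨a, ha⟩) (hlt ⟨b, hb⟩)).1,
      (image_cellQuad_whiteCells hW).ge⟩
  let iso : cellGraph (whiteCells Q m W) ≃g whiteGraph W :=
    { toEquiv := hbij.equiv _
      map_rel_iff' {a b} := by
        change hbij.equiv _ a ≠ hbij.equiv _ b ∧
          HaveCommonSide (cellQuad Q m a) (cellQuad Q m b) ↔ Neighbor a b
        rw [Ne, EmbeddingLike.apply_eq_iff_eq]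
        by_cases hab : a = b
        · simp [hab, neighbor_iff]
        · rw [and_iff_right hab]
          exact haveCommonSide_cellQuad_iff hQ (hlt a) (hlt b) fun e => hab (Subtype.ext e) }
  exact iso.isTree_iff.2 htree

theorem isBorderIndex_cellIndex (h : a.1 = 0 ∨ a.2 = 0 ∨ a.1 = m - 1 ∨ a.2 = m - 1) :
    IsBorderIndex (cellIndex m a) := by
  simp only [IsBorderIndex, Fin.exists_fin_succ, Fin.forall_fin_succ, cellIndex]
  simp
  omega

theorem IsLeftRightPair.eq_cellQuad (h : IsLeftRightPair Q m W k) :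
    k 1 < m ∧ S Q m k = cellQuad Q m (k 1, 0) ∧
      S Q m ![0, 0, k 1, k 0] = cellQuad Q m (k 1, m - 1) := by
  obtain ⟨hk, h₂, h₃, -, -⟩ := h
  obtain ⟨hlt, -, hk⟩ := lt_and_eq_cellIndex hk
  rw [h₂, h₃, add_zero] at hk
  rw [h₂, add_zero] at hlt
  have hk₀ : k 0 = m - 1 - k 1 := by simpa [cellIndex] using congrFun hk 0
  have hk' : ![0, 0, k 1, k 0] = cellIndex m (k 1, m - 1) := by
    rw [cellIndex_upper (by grind), hk₀, Nat.sub_self]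
  refine ⟨hlt, ?_, ?_⟩
  · rw [← S_cellIndex Q hlt hlt.pos, ← hk]
  · rw [hk', S_cellIndex Q hlt (Nat.sub_one_lt_of_lt hlt)]

theorem IsTopBottomPair.eq_cellQuad (h : IsTopBottomPair Q m W k) :
    k 3 < m ∧ S Q m k = cellQuad Q m (0, k 3) ∧
      S Q m ![0, k 0, k 3, 0] = cellQuad Q m (m - 1, k 3) := by
  obtain ⟨hk, h₁, h₂, -, -⟩ := h
  obtain ⟨-, hlt, hk⟩ := lt_and_eq_cellIndex hk
  rw [h₁, h₂, zero_add, zero_add] at hk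
  rw [h₂, zero_add] at hlt
  have hk₀ : k 0 = m - 1 - k 3 := by simpa [cellIndex] using congrFun hk 0
  have hk' : ![0, k 0, k 3, 0] = cellIndex m (m - 1, k 3) := by
    rw [cellIndex_lower (by grind), hk₀, Nat.sub_self]
  refine ⟨hlt, ?_, ?_⟩
  · rw [← S_cellIndex Q hlt.pos hlt, ← hk]
  · rw [hk', S_cellIndex Q (Nat.sub_one_lt_of_lt hlt) hlt]

/-- The conditions on a labyrinth set without border quadrilaterals other than the exits, in terms
of its cells. In contrast to `IsPattern`, an exit may lie in a corner of the grid. -/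
structure HasExits (m : ℕ) (w : Set (ℕ × ℕ)) (c r : ℕ) : Prop where
  lt : ∀ a ∈ w, a.1 < m ∧ a.2 < m
  left : (0, r) ∈ w
  right : (m - 1, r) ∈ w
  bottom : (c, 0) ∈ w
  top : (c, m - 1) ∈ w
  border : ∀ a ∈ w, (a.1 = 0 ∨ a.2 = 0 ∨ a.1 = m - 1 ∨ a.2 = m - 1) →
    a.1 = c ∧ (a.2 = 0 ∨ a.2 = m - 1) ∨ a.2 = r ∧ (a.1 = 0 ∨ a.1 = m - 1)
  corner₁₃ : ¬ ((0, 0) ∈ w ∧ (m - 1, m - 1) ∈ w)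
  corner₂₄ : ¬ ((m - 1, 0) ∈ w ∧ (0, m - 1) ∈ w)
  tree : (cellGraph w).IsTree

theorem HasExits.swap (h : HasExits m w c r) : HasExits m (Prod.swap ⁻¹' w) r c where
  lt _ ha := (h.lt _ ha).symm
  left := h.bottom
  right := h.top
  bottom := h.left
  top := h.right
  border a ha hb := (h.border _ ha (by simp only [Prod.fst_swap, Prod.snd_swap]; omega)).symm
  corner₁₃ := h.corner₁₃
  corner₂₄ h' := h.corner₂₄ h'.symm
  tree := (cellGraphSwap w).isTree_iff.1 h.tree

theorem HasExits.exists_neighbor (h : HasExits m w c r) (ha : a ∈ w) (hb : b ∈ w) (hab : a ≠ b) :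
    ∃ d ∈ w, Neighbor a d := by
  have : Nontrivial w := ⟨⟨a, ha⟩, ⟨b, hb⟩, fun e => hab (congrArg Subtype.val e)⟩
  obtain ⟨d, hd⟩ := h.tree.connected.preconnected.exists_adj_of_nontrivial ⟨a, ha⟩
  exact ⟨d, d.2, hd⟩

theorem HasExits.exit_ne_corner (hm : 4 ≤ m) (h : HasExits m w c r) : 0 < c ∧ c + 1 < m := by
  have hcm : c < m := (h.lt _ h.bottom).1
  by_contra hcon
  have hc : c = 0 ∨ c = m - 1 := by omega
  have hr₀ : r ≠ 0 := by
    rintro rfl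
    rcases hc with rfl | rfl
    · exact h.corner₂₄ ⟨h.right, h.top⟩
    · exact h.corner₁₃ ⟨h.left, h.top⟩
  have hr₁ : r ≠ m - 1 := by
    rintro rfl
    rcases hc with rfl | rfl
    · exact h.corner₁₃ ⟨h.bottom, h.right⟩
    · exact h.corner₂₄ ⟨h.bottom, h.left⟩
  -- A neighbour of a corner exit is a border cell, hence an exit, and so it lies in row `r`.
  have hne : (c, 0) ≠ (c, m - 1) := by simp only [ne_eq, Prod.mk.injEq]; omega
  have hr_eq_one : r = 1 := by
    obtain ⟨d, hd, hcd⟩ := h.exists_neighbor h.bottom h.top hne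
    have hd_lt := h.lt _ hd
    rw [neighbor_iff] at hcd
    have := h.border d hd (by omega)
    omega
  have hr_eq_sub : r = m - 2 := by
    obtain ⟨d, hd, hcd⟩ := h.exists_neighbor h.top h.bottom hne.symm
    have hd_lt := h.lt _ hd
    rw [neighbor_iff] at hcd
    have := h.border d hd (by omega)
    omega
  omega

theorem HasExits.isPattern (hm : 4 ≤ m) (h : HasExits m w c r) : IsPattern m w c r := by
  obtain ⟨hc₀, hc₁⟩ := h.exit_ne_corner hm
  obtain ⟨hr₀, hr₁⟩ := h.swap.exit_ne_corner hm
  exact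
    { lt := h.lt
      left y := ⟨fun hy => by have := h.border _ hy; omega, fun e => e ▸ h.left⟩
      right y := ⟨fun hy => by have := h.border _ hy; omega, fun e => e ▸ h.right⟩
      bottom x := ⟨fun hx => by have := h.border _ hx; omega, fun e => e ▸ h.bottom⟩
      top x := ⟨fun hx => by have := h.border _ hx; omega, fun e => e ▸ h.top⟩
      c_pos := hc₀
      c_lt := hc₁
      r_pos := hr₀
      r_lt := hr₁
      tree := h.tree }

theorem exists_pair_of_isExit (hQ : IsConvexQuad Q) (ha : a.1 < m ∧ a.2 < m)
    (h : IsExit Q m W (cellQuad Q m a)) :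
    (∃ k, IsLeftRightPair Q m W k ∧ a.1 = k 1 ∧ (a.2 = 0 ∨ a.2 = m - 1)) ∨
      ∃ l, IsTopBottomPair Q m W l ∧ a.2 = l 3 ∧ (a.1 = 0 ∨ a.1 = m - 1) := by
  refine h.imp ?_ ?_
  · rintro ⟨k, hk, e⟩
    obtain ⟨hlt, e₁, e₂⟩ := hk.eq_cellQuad
    rw [e₁, e₂, cellQuad_inj hQ ha ⟨hlt, by grind⟩, cellQuad_inj hQ ha ⟨hlt, by grind⟩] at e
    grind
  · rintro ⟨k, hk, e⟩
    obtain ⟨hlt, e₁, e₂⟩ := hk.eq_cellQuad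
    rw [e₁, e₂, cellQuad_inj hQ ha ⟨by grind, hlt⟩, cellQuad_inj hQ ha ⟨by grind, hlt⟩] at e
    grind

theorem IsLabyrinthSet.exists_hasExits (hQ : IsConvexQuad Q) (hW : IsLabyrinthSet Q m W)
    (hborder : ∀ k ∈ A m, IsBorderIndex k → S Q m k ∈ W → IsExit Q m W (S Q m k)) :
    ∃ c r, HasExits m (whiteCells Q m W) c r := by
  obtain ⟨k, hk, hk_unique⟩ := hW.exit_left_right
  obtain ⟨l, hl, hl_unique⟩ := hW.exit_top_bottom
  obtain ⟨hc, hbottom, htop⟩ := hk.eq_cellQuad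
  obtain ⟨hr, hleft, hright⟩ := hl.eq_cellQuad
  have hm : m - 1 < m := Nat.sub_one_lt_of_lt hc
  exact ⟨k 1, l 3,
    { lt _ ha := ⟨ha.1, ha.2.1⟩
      left := ⟨hr.pos, hr, hleft ▸ hl.2.2.2.1⟩
      right := ⟨hm, hr, hright ▸ hl.2.2.2.2⟩
      bottom := ⟨hc, hc.pos, hbottom ▸ hk.2.2.2.1⟩
      top := ⟨hc, hm, htop ▸ hk.2.2.2.2⟩
      border := by
        rintro a ⟨ha₁, ha₂, ha⟩ hb
        rw [← S_cellIndex Q ha₁ ha₂] at ha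
        have hexit := hborder _ (cellIndex_mem ha₁ ha₂) (isBorderIndex_cellIndex hb) ha
        rw [S_cellIndex Q ha₁ ha₂] at hexit
        rcases exists_pair_of_isExit hQ ⟨ha₁, ha₂⟩ hexit with ⟨k', hk', h⟩ | ⟨l', hl', h⟩
        · exact .inl (hk_unique k' hk' ▸ h)
        · exact .inr (hl_unique l' hl' ▸ h)
      corner₁₃ := by
        rintro ⟨⟨-, -, h⟩, ⟨-, -, h'⟩⟩
        rw [← S_cellIndex Q hc.pos hc.pos] at h
        rw [← S_cellIndex Q hm hm] at h'
        refine hW.corner₁₃ ⟨?_, ?_⟩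
        · simpa [cellIndex] using h
        · simpa [cellIndex] using h'
      corner₂₄ := by
        rintro ⟨⟨-, -, h⟩, ⟨-, -, h'⟩⟩
        rw [← S_cellIndex Q hm hc.pos] at h
        rw [← S_cellIndex Q hc.pos hm] at h'
        refine hW.corner₂₄ ⟨?_, ?_⟩
        · simpa [cellIndex] using h
        · simpa [cellIndex] using h'
      tree := isTree_cellGraph hQ hW.subset_grid hW.tree }⟩

end

/-! ### The components of the complement -/

section

open Set

theorem bijective_mk_of_separated {X ι : Type*} [TopologicalSpace X] {q : ι → X} {g : X → ι}
    [TopologicalSpace ι] [TotallyDisconnectedSpace ι] (hg : Continuous g) (hgq : ∀ i, g (q i) = i)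
    (hq : ∀ x, ∃ i, q i ∈ connectedComponent x) :
    Function.Bijective fun i => (ConnectedComponents.mk (q i) : ConnectedComponents X) := by
  refine ⟨fun i j hij => ?_, fun x => ?_⟩
  · rw [← hgq i, ← hgq j]
    exact hg.image_eq_of_connectedComponent_eq _ _ (ConnectedComponents.coe_eq_coe.1 hij)
  · obtain ⟨x, rfl⟩ := ConnectedComponents.surjective_coe x
    obtain ⟨i, hi⟩ := hq x
    exact ⟨i, ConnectedComponents.coe_eq_coe'.2 hi⟩

theorem exists_homeomorph_image {E F : Type*} [TopologicalSpace E] [TopologicalSpace F] [T2Space F]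
    {f : E → F} {K Y : Set E} (hK : IsCompact K) (hYK : Y ⊆ K) (hf : ContinuousOn f K)
    (hinj : InjOn f K) : ∃ e : Y ≃ₜ f '' Y, ∀ y (hy : y ∈ Y), (e ⟨y, hy⟩ : F) = f y := by
  have : CompactSpace K := isCompact_iff_compactSpace.1 hK
  have hembK : Topology.IsEmbedding (K.domRestrict f) :=
    (hf.domRestrict.isClosedEmbedding hinj.injective).isEmbedding
  have hemb : Topology.IsEmbedding (Y.domRestrict f) := hembK.comp (.inclusion hYK)
  exact ⟨hemb.toHomeomorph.trans (.setCongr (range_domRestrict f Y)), fun _ _ => rfl⟩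

theorem bijective_mk_image_of_separated {E F ι : Type*} [TopologicalSpace E] [TopologicalSpace F]
    [T2Space F] [TopologicalSpace ι] [TotallyDisconnectedSpace ι] {f : E → F} {K Y : Set E}
    (hK : IsCompact K) (hYK : Y ⊆ K) (hf : ContinuousOn f K) (hinj : InjOn f K) {q : ι → E}
    {g : E → ι} (hg : ContinuousOn g Y) (hgq : ∀ i, g (q i) = i) (hqY : ∀ i, q i ∈ Y)
    (hq : ∀ y ∈ Y, ∃ i, q i ∈ connectedComponentIn Y y) :
    Function.Bijective fun i =>
      (ConnectedComponents.mk (⟨f (q i), mem_image_of_mem f (hqY i)⟩ : ↥(f '' Y))) := by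
  obtain ⟨e, he⟩ := exists_homeomorph_image hK hYK hf hinj
  have hq_eq (i : ι) : (⟨f (q i), mem_image_of_mem f (hqY i)⟩ : ↥(f '' Y)) = e ⟨q i, hqY i⟩ :=
    Subtype.ext (he _ _).symm
  simp only [hq_eq]
  refine bijective_mk_of_separated (g := fun x => g (e.symm x)) ?_ ?_ fun x => ?_
  · exact hg.domRestrict.comp e.symm.continuous
  · simpa using hgq
  · obtain ⟨i, hi⟩ := hq _ (e.symm x).2
    refine ⟨i, ?_⟩
    rw [connectedComponentIn_eq_image (e.symm x).2, Subtype.coe_eta] at hi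
    obtain ⟨y, hy, hyi⟩ := hi
    have hey := e.continuous.mapsTo_connectedComponent _ hy
    rwa [e.apply_symm_apply, show y = ⟨q i, hqY i⟩ from Subtype.ext hyi] at hey

theorem theorem4p4_general (Q : Quad) (hQ : IsConvexQuad Q) (m : ℕ) (hm : 4 ≤ m) (W : Set Quad)
    (hW : IsLabyrinthSet Q m W)
    (hborder : ∀ k ∈ A m, IsBorderIndex k → S Q m k ∈ W → IsExit Q m W (S Q m k)) :
    Nat.card (ConnectedComponents ↥(carrier Q \ fractal Q W)) = 4 ∧
    ∃ h : ∀ i : Fin 4, Q i ∈ carrier Q \ fractal Q W,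
      Function.Bijective (fun i : Fin 4 =>
        (ConnectedComponents.mk (⟨Q i, h i⟩ : ↥(carrier Q \ fractal Q W)))) := by
  obtain ⟨c, r, hexits⟩ := hW.exists_hasExits hQ hborder
  have hp := hexits.isPattern hm
  obtain ⟨g, hg, hgq⟩ := hp.exists_continuousOn_corner
  have hbij := bijective_mk_image_of_separated (K := unitSq) (Y := squareComplement m _)
    (isCompact_Icc.prod isCompact_Icc) sdiff_subset (continuous_quadMap Q).continuousOn
    (injOn_quadMap hQ) hg hgq hp.corner_mem_squareComplement
    fun _ => hp.exists_corner_mem_connectedComponentIn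
  simp only [quadMap_corner] at hbij
  rw [carrier_diff_fractal_eq_image hQ hW.subset_grid hp]
  refine ⟨?_, fun i => ⟨corner i, hp.corner_mem_squareComplement i, quadMap_corner Q i⟩, hbij⟩
  rw [← Nat.card_eq_of_bijective _ hbij, Nat.card_fin]

end

end QuadLabyrinth

theorem theorem4p4 (Q : Quad) (hQ : IsConvexQuad Q)
    (hdiag : dist (Q 0) (Q 2) ≤ dist (Q 1) (Q 3))
    (m : ℕ) (hm : 4 ≤ m) (W : Set Quad) (hW : IsLabyrinthSet Q m W)
    (hborder : ∀ k ∈ A m, IsBorderIndex k → S Q m k ∈ W → IsExit Q m W (S Q m k)) :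
    Nat.card (ConnectedComponents ↥(carrier Q \ fractal Q W)) = 4 ∧
    ∃ h : ∀ i : Fin 4, Q i ∈ carrier Q \ fractal Q W,
      Function.Bijective (fun i : Fin 4 =>
        (ConnectedComponents.mk (⟨Q i, h i⟩ : ↥(carrier Q \ fractal Q W)))) :=
  theorem4p4_general Q hQ m hm W hW hborder
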